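/- Let $\mathbb D$ be the open unit disk, $\mathbb T$ the unit circle and $m$ normalized arclength measure on $\mathbb T$. Let $\theta$ be a nonconstant inner function, i.e. a nonconstant bounded holomorphic function on $\mathbb D$ with $\lim_{r\to1^-}|\theta(r\zeta)|=1$ for almost all $\zeta\in\mathbb T$, and suppose that $\theta'$ belongs to the Nevanlinna class, i.e. $$\sup_{0<r<1}\int_{\mathbb T}\log^+|\theta'(r\zeta)|\,dm(\zeta)<\infty.$$ Then $\theta'$ has a finite nonzero nontangential limit, denoted by $\theta'(\zeta)$, at almost every $\zeta\in\mathbb T$; the function $\log|\theta'|$ is in $L^1(\mathbb T,m)$; and the outer function with modulus $|\theta'|$ on $\mathbb T$, $$\mathcal O(z)=\exp\left\{\int_{\mathbb T}\frac{\zeta+z}{\zeta-z}\,\log|\theta'(\zeta)|\,dm(\zeta)\right\},\qquad z\in\mathbb D,$$ satisfies $$\frac{1-|\theta(z)|^2}{1-|z|^2}\le|\mathcal O(z)|\qquad\text{for all } z\in\mathbb D.$$ -/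

import Mathlib

open Complex Filter Topology MeasureTheory Metric

noncomputable section

namespace DiskFunctions

/-- `f` belongs to `H^∞`: it is holomorphic and bounded on the open unit disk. -/
def IsHInfty (f : ℂ → ℂ) : Prop :=
  DifferentiableOn ℂ f (ball 0 1) ∧ ∃ C : ℝ, ∀ z ∈ ball (0 : ℂ) 1, ‖f z‖ ≤ C

/-- `f` is an inner function: `f ∈ H^∞` and its radial limits have modulus `1` almost everywhere
on the unit circle. (`circleMap 0 r t = r * exp (t * I)`; a subset of the circle is null iff the
set of its arguments `t` is Lebesgue null.) -/
def IsInner (f : ℂ → ℂ) : Prop :=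
  IsHInfty f ∧
    ∀ᵐ t : ℝ, Tendsto (fun r : ℝ => ‖f (circleMap 0 r t)‖) (𝓝[<] 1) (𝓝 1)

/-- The Nevanlinna class: holomorphic functions on the unit disk whose means of `log⁺ |f|` over
the circles `|z| = r`, `0 < r < 1`, are bounded. -/
def IsNevanlinna (f : ℂ → ℂ) : Prop :=
  DifferentiableOn ℂ f (ball 0 1) ∧
    ∃ C : ℝ, ∀ r ∈ Set.Ioo (0 : ℝ) 1, Real.circleAverage (fun z => Real.posLog ‖f z‖) 0 r ≤ C

/-- The Stolz region of aperture `M` with vertex at the point `ζ` of the unit circle. -/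
def stolzRegion (ζ : ℂ) (M : ℝ) : Set ℂ :=
  {z | ‖z‖ < 1 ∧ ‖ζ - z‖ < M * (1 - ‖z‖)}

/-- The filter of nontangential approach to `ζ` from within the unit disk: a function tends to a
limit along it iff it does so within each Stolz region at `ζ`. -/
def nontangential (ζ : ℂ) : Filter ℂ :=
  ⨆ M : ℝ, 𝓝[stolzRegion ζ M] ζ

/-- The nontangential boundary value of `f` at `ζ` (meaningful when the limit exists). -/
def boundaryValue (f : ℂ → ℂ) (ζ : ℂ) : ℂ :=
  limUnder (nontangential ζ) f

/-- The outer function with modulus `h` on the unit circle,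
`z ↦ exp (∫ (ζ + z) / (ζ - z) * log (h ζ) dm(ζ))`, `m` being normalized arclength. Here
`herglotzRieszKernel 0 z ζ` is `(ζ + z) / (ζ - z)`. -/
def outer (h : ℂ → ℝ) (z : ℂ) : ℂ :=
  exp (Real.circleAverage (fun ζ => herglotzRieszKernel 0 z ζ * (Real.log (h ζ) : ℂ)) 0 1)

end DiskFunctions

end

noncomputable section

namespace DiskFunctions

open scoped ComplexConjugate

/-! The two-point Schwarz–Pick inequality relates `θ z` to `θ u`. Letting `u` tend radially to a
boundary point `ζ` where `θ` has a unimodular limit `θ(ζ)` and `θ'` a limit `θ'(ζ)` gives Julia's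
inequality (`julia_inequality`): `(1 - |z|²) |1 - conj (θ z) θ(ζ)|² ≤ (1 - |θ z|²) |1 - conj z ζ|²
|θ'(ζ)|`.

Fix `z`, take logarithms and integrate in `ζ` against the Poisson kernel at `z`. With `a = θ z`, the
functions `log (1 - conj a θ)` and `log (1 - conj z ζ)` are boundary values of bounded holomorphic
functions, so the Poisson formula evaluates the real parts of their integrals as `log (1 - |a|²)`
and `log (1 - |z|²)`. What remains is `log ((1 - |a|²) / (1 - |z|²))`, bounded by the Poisson
integral of `log |θ'|`, that is, by `log |𝒪(z)|`.

At `z = 0` Julia's inequality bounds `|θ'|` below by a positive constant, so its limits are nonzero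
and `log |θ'|` is integrable from below; Fatou's lemma controls `log⁺ |θ'|`.

The boundary values come from Fatou's theorem. For bounded `g`, a primitive is Lipschitz, hence
differentiable along the circle almost everywhere, and such differentiability forces nontangential
convergence of `g` (`tendsto_deriv_nontangential`). A Nevanlinna function is a quotient of bounded
ones (`IsNevanlinna.exists_quotient`), whose denominator has nonzero limits by Jensen's inequality
(`ae_radial_limit_ne_zero`). -/

/-! ### Nontangential approach and null sets of the circle. -/

lemma circleMap_zero_mem_ball {r : ℝ} (hr : 0 ≤ r) (hr1 : r < 1) (t : ℝ) :
    circleMap 0 r t ∈ ball (0 : ℂ) 1 := by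
  simpa [abs_of_nonneg hr] using hr1

lemma eventually_mem_Ioo_nhdsLT_one : ∀ᶠ r : ℝ in 𝓝[<] 1, r ∈ Set.Ioo (0 : ℝ) 1 :=
  Ioo_mem_nhdsLT one_pos

lemma circleMap_zero_eq_mul (r t : ℝ) : circleMap 0 r t = r * circleMap 0 1 t := by
  simp [circleMap]

/-- Radial approach is nontangential. -/
lemma tendsto_circleMap_nontangential (t : ℝ) :
    Tendsto (fun r : ℝ => circleMap 0 r t) (𝓝[<] 1) (nontangential (circleMap 0 1 t)) := by
  have h : Tendsto (fun r : ℝ => circleMap 0 r t) (𝓝[<] 1)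
      (𝓝[stolzRegion (circleMap 0 1 t) 2] (circleMap 0 1 t)) := by
    refine tendsto_nhdsWithin_iff.2 ⟨?_, ?_⟩
    · have : Continuous fun r : ℝ => circleMap 0 r t := by
        unfold circleMap; fun_prop
      exact (this.tendsto 1).mono_left nhdsWithin_le_nhds
    · filter_upwards [eventually_mem_Ioo_nhdsLT_one] with r hr
      have h1 : ‖circleMap 0 r t‖ = r := by simp [abs_of_pos hr.1]
      refine ⟨by rw [h1]; exact hr.2, ?_⟩
      rw [h1, circleMap_zero_eq_mul r, ← one_sub_mul, norm_mul]
      have h2 : ‖(1 : ℂ) - r‖ = 1 - r := by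
        rw [← ofReal_one, ← ofReal_sub, norm_real, Real.norm_of_nonneg (by linarith [hr.2])]
      rw [h2, norm_circleMap_zero]
      norm_num
      linarith [hr.2]
  exact h.mono_right (le_iSup (fun M : ℝ => 𝓝[stolzRegion (circleMap 0 1 t) M] (circleMap 0 1 t)) 2)

instance nontangential_circleMap_neBot (t : ℝ) : (nontangential (circleMap 0 1 t)).NeBot :=
  (tendsto_circleMap_nontangential t).neBot

lemma eventually_mem_ball_nontangential (ζ : ℂ) :
    ∀ᶠ z in nontangential ζ, z ∈ ball (0 : ℂ) 1 := by
  simp only [nontangential, eventually_iSup]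
  intro M
  filter_upwards [self_mem_nhdsWithin] with z hz
  simpa using hz.1

/-- A `2π`-periodic property that holds almost everywhere on a period holds almost everywhere. -/
lemma ae_of_ae_restrict_period {p : ℝ → Prop} (hp : ∀ (t : ℝ) (n : ℤ), p (t + n * (2 * Real.pi)) → p t)
    (h : ∀ᵐ t ∂volume.restrict (Set.uIoc 0 (2 * Real.pi)), p t) : ∀ᵐ t : ℝ, p t := by
  have h' := (ae_restrict_iff' measurableSet_uIoc).1 h
  have h2 : ∀ᵐ t : ℝ, ∀ n : ℤ, t + n * (2 * Real.pi) ∈ Set.uIoc 0 (2 * Real.pi) →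
      p (t + n * (2 * Real.pi)) :=
    ae_all_iff.2 fun n =>
      (measurePreserving_add_right volume ((n : ℝ) * (2 * Real.pi))).quasiMeasurePreserving.ae h'
  filter_upwards [h2] with t ht
  have hmem := toIocMod_mem_Ioc Real.two_pi_pos 0 t
  rw [toIocMod, zero_add] at hmem
  refine hp t (-toIocDiv Real.two_pi_pos 0 t) (ht _ ?_)
  rw [Set.uIoc_of_le Real.two_pi_pos.le]
  rw [zsmul_eq_mul] at hmem
  convert hmem using 1
  push_cast
  ring

lemma circleMap_add_int_mul_two_pi (r t : ℝ) (n : ℤ) :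
    circleMap 0 r (t + n * (2 * Real.pi)) = circleMap 0 r t := by
  have := (periodic_circleMap 0 r).int_mul n t
  simpa using this

/-! ### The Schwarz–Pick inequality. -/

lemma norm_one_sub_conj_mul_sq_sub (z u : ℂ) :
    ‖1 - conj z * u‖ ^ 2 - ‖u - z‖ ^ 2 = (1 - ‖u‖ ^ 2) * (1 - ‖z‖ ^ 2) := by
  simp only [← normSq_eq_norm_sq, normSq_apply]
  simp
  ring

lemma one_sub_conj_mul_ne_zero {z u : ℂ} (hz : ‖z‖ < 1) (hu : ‖u‖ ≤ 1) : 1 - conj z * u ≠ 0 := by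
  intro h
  have : ‖conj z * u‖ = 1 := by rw [← sub_eq_zero.1 h]; simp
  rw [norm_mul, RCLike.norm_conj] at this
  nlinarith [norm_nonneg z, norm_nonneg u]

/-- The **Schwarz–Pick inequality** for two points. -/
lemma schwarz_pick {f : ℂ → ℂ} (hf : DifferentiableOn ℂ f (ball 0 1))
    (hb : ∀ z ∈ ball (0 : ℂ) 1, ‖f z‖ < 1) {z u : ℂ} (hz : z ∈ ball (0 : ℂ) 1)
    (hu : u ∈ ball (0 : ℂ) 1) :
    (1 - ‖z‖ ^ 2) * (1 - ‖u‖ ^ 2) * ‖1 - conj (f z) * f u‖ ^ 2 ≤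
      (1 - ‖f z‖ ^ 2) * (1 - ‖f u‖ ^ 2) * ‖1 - conj z * u‖ ^ 2 := by
  have hz1 : ‖z‖ < 1 := by simpa using hz
  have hu1 : ‖u‖ < 1 := by simpa using hu
  have hmob : ∀ {a w : ℂ}, ‖a‖ < 1 → ‖w‖ < 1 → ‖(w - a) / (1 - conj a * w)‖ < 1 := by
    intro a w ha hw
    have h0 := norm_pos_iff.2 (one_sub_conj_mul_ne_zero ha hw.le)
    rw [norm_div, div_lt_one h0]
    have := norm_one_sub_conj_mul_sq_sub a w
    have h1 : 0 < (1 - ‖w‖ ^ 2) * (1 - ‖a‖ ^ 2) := by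
      apply mul_pos <;> nlinarith [norm_nonneg a, norm_nonneg w]
    nlinarith [norm_nonneg (w - a)]
  -- `φ` is the disk automorphism taking `0` to `z`. Composing `f ∘ φ` with the automorphism taking
  -- `f z` to `0` gives a map `b` fixing `0`, to which Schwarz's lemma applies.
  set φ : ℂ → ℂ := fun w => (w - -z) / (1 - conj (-z) * w) with hφ
  have hφm : ∀ w ∈ ball (0 : ℂ) 1, φ w ∈ ball (0 : ℂ) 1 := fun w hw => by
    rw [mem_ball_zero_iff] at hw ⊢
    exact hmob (a := -z) (by simpa using hz1) hw
  have hφd : DifferentiableOn ℂ φ (ball 0 1) := by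
    refine DifferentiableOn.div (by fun_prop) (by fun_prop) fun w hw => ?_
    exact one_sub_conj_mul_ne_zero (by simpa using hz1) (by simpa using (mem_ball.1 hw).le)
  set b : ℂ → ℂ := fun w => (f (φ w) - f z) / (1 - conj (f z) * f (φ w)) with hbdef
  have hfφ : DifferentiableOn ℂ (fun w => f (φ w)) (ball 0 1) := hf.comp hφd hφm
  have hbd : DifferentiableOn ℂ b (ball 0 1) := by
    refine DifferentiableOn.div (hfφ.sub_const _) ((hfφ.const_mul _).const_sub _) fun w hw => ?_
    exact one_sub_conj_mul_ne_zero (hb z hz) (hb _ (hφm w hw)).le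
  have hbm : Set.MapsTo b (ball 0 1) (closedBall 0 1) := fun w hw =>
    mem_closedBall_zero_iff.2 (hmob (hb z hz) (hb _ (hφm w hw))).le
  have hb0 : b 0 = 0 := by simp [hbdef, hφ]
  set w : ℂ := (u - z) / (1 - conj z * u)
  have hw : ‖w‖ < 1 := hmob hz1 hu1
  have hd : 1 - conj z * u ≠ 0 := one_sub_conj_mul_ne_zero hz1 hu1.le
  have hzz : 1 - conj z * z ≠ 0 := one_sub_conj_mul_ne_zero hz1 hz1.le
  have hφw : φ w = u := by
    have e1 : w - -z = u * (1 - conj z * z) / (1 - conj z * u) := by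
      rw [eq_div_iff hd, sub_mul, div_mul_cancel₀ _ hd]; ring
    have e2 : 1 - conj (-z) * w = (1 - conj z * z) / (1 - conj z * u) := by
      rw [eq_div_iff hd, sub_mul, mul_assoc, div_mul_cancel₀ _ hd, map_neg]; ring
    simp only [hφ, e1, e2]
    rw [div_div_div_cancel_right₀ hd, mul_div_cancel_right₀ _ hzz]
  have key := norm_le_norm_of_mapsTo_ball hbd hbm hb0 hw
  simp only [hbdef, hφw, w, norm_div] at key
  have hd' := norm_pos_iff.2 hd
  have hD' := norm_pos_iff.2 (one_sub_conj_mul_ne_zero (hb z hz) (hb u hu).le)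
  rw [div_le_div_iff₀ hD' hd'] at key
  have k2 := pow_le_pow_left₀ (by positivity) key 2
  rw [mul_pow, mul_pow] at k2
  have i1 := norm_one_sub_conj_mul_sq_sub z u
  have i2 := norm_one_sub_conj_mul_sq_sub (f z) (f u)
  linear_combination k2 - ‖1 - conj (f z) * f u‖ ^ 2 * i1 + ‖1 - conj z * u‖ ^ 2 * i2

/-! ### The Poisson kernel of the unit disk. -/

lemma norm_circleAverage_le {E : Type*} [NormedAddCommGroup E] [NormedSpace ℝ E] {f : ℂ → E}
    {g : ℂ → ℝ} {R : ℝ} (hg : CircleIntegrable g 0 R)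
    (h : ∀ ζ ∈ sphere (0 : ℂ) |R|, ‖f ζ‖ ≤ g ζ) :
    ‖Real.circleAverage f 0 R‖ ≤ Real.circleAverage g 0 R := by
  rw [Real.circleAverage, Real.circleAverage, norm_smul, smul_eq_mul, Real.norm_of_nonneg (by positivity)]
  gcongr
  exact intervalIntegral.norm_integral_le_of_norm_le Real.two_pi_pos.le
    (ae_of_all _ fun t _ => h _ (circleMap_mem_sphere' 0 R t)) hg

lemma continuousOn_poissonKernel_sphere {z : ℂ} (hz : z ∈ ball (0 : ℂ) 1) :
    ContinuousOn (poissonKernel 0 z) (sphere 0 1) := by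
  rw [poissonKernel_eq_re_herglotzRieszKernel]
  have := continuousOn_herglotzRieszKernel_sphere hz
  rw [abs_one] at this
  exact continuous_re.comp_continuousOn this

lemma circleAverage_poissonKernel {z : ℂ} (hz : z ∈ ball (0 : ℂ) 1) :
    Real.circleAverage (poissonKernel 0 z) 0 1 = 1 := by
  have h : DiffContOnCl ℂ (fun _ : ℂ => (1 : ℂ)) (ball 0 1) := diffContOnCl_const
  have h1 := h.circleAverage_poissonKernel_smul hz
  have h2 := Complex.reCLM.circleAverage_comp_comm (f := poissonKernel 0 z • fun _ : ℂ => (1 : ℂ))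
    (c := 0) (R := 1) (ContinuousOn.circleIntegrable zero_le_one
      ((continuousOn_poissonKernel_sphere hz).smul continuousOn_const))
  rw [h1] at h2
  have h3 : ⇑reCLM ∘ (poissonKernel 0 z • fun _ : ℂ => (1 : ℂ)) = poissonKernel 0 z := by
    ext ζ
    simp
  rw [h3] at h2
  simpa using h2

lemma poissonKernel_nonneg {z ζ : ℂ} (hz : ‖z‖ ≤ 1) (hζ : ‖ζ‖ = 1) : 0 ≤ poissonKernel 0 z ζ := by
  simp only [poissonKernel, sub_zero, hζ]
  have : ‖z‖ ^ 2 ≤ 1 := pow_le_one₀ (norm_nonneg _) hz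
  exact div_nonneg (by linarith) (by positivity)

lemma norm_one_sub_conj_mul_of_norm_eq_one {z ζ : ℂ} (hζ : ‖ζ‖ = 1) :
    ‖1 - conj z * ζ‖ = ‖ζ - z‖ := by
  have := norm_one_sub_conj_mul_sq_sub z ζ
  rw [hζ] at this
  norm_num at this
  exact (pow_left_inj₀ (norm_nonneg _) (norm_nonneg _) two_ne_zero).1 (by linarith)

/-! ### Fatou's theorem for bounded functions. -/

/-- The kernel reproducing `F'` from boundary values of `F`, with cubic decay off the diagonal. -/
def derivKernel (z ζ : ℂ) : ℂ :=
  ζ / (ζ - z) ^ 2 - ζ * (conj z ^ 2 / (1 - conj z * ζ) ^ 2)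

/-- With `a = ζ - z` and `b = 1 - conj z * ζ`, the numerator `b² - (conj z * a)²` has the factor `b
+ conj z * a = 1 - |z|²`, while `|a| = |b|` on the circle bounds the other factor by `2 |a|`. -/
lemma norm_derivKernel_le {z ζ : ℂ} (hz : ‖z‖ < 1) (hζ : ‖ζ‖ = 1) :
    ‖derivKernel z ζ‖ ≤ 2 * poissonKernel 0 z ζ / ‖ζ - z‖ := by
  have hne : ζ - z ≠ 0 := fun h => by rw [sub_eq_zero] at h; rw [h] at hζ; linarith
  have hne' : 1 - conj z * ζ ≠ 0 := one_sub_conj_mul_ne_zero hz hζ.le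
  have e : derivKernel z ζ = ζ * ((1 - conj z * z) * ((1 - conj z * ζ) - conj z * (ζ - z))) /
      ((ζ - z) ^ 2 * (1 - conj z * ζ) ^ 2) := by
    have h1 : 1 - conj z * z = (1 - conj z * ζ) + conj z * (ζ - z) := by ring
    rw [h1, derivKernel]
    generalize ζ - z = a at hne
    generalize 1 - conj z * ζ = b at hne'
    field_simp
    ring
  have hzz : conj z * z = ((‖z‖ ^ 2 : ℝ) : ℂ) := by
    rw [← normSq_eq_norm_sq, mul_comm, mul_conj]
  have hpos : 0 < ‖ζ - z‖ := norm_pos_iff.2 hne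
  have h1 : ‖1 - conj z * z‖ = 1 - ‖z‖ ^ 2 := by
    rw [hzz, ← ofReal_one, ← ofReal_sub, norm_real, Real.norm_of_nonneg]
    have : ‖z‖ ^ 2 ≤ 1 := pow_le_one₀ (norm_nonneg _) hz.le
    linarith
  have h2 : ‖(1 - conj z * ζ) - conj z * (ζ - z)‖ ≤ 2 * ‖ζ - z‖ := by
    refine (norm_sub_le _ _).trans ?_
    rw [norm_one_sub_conj_mul_of_norm_eq_one hζ, norm_mul, RCLike.norm_conj]
    nlinarith
  rw [e, norm_div, norm_mul, norm_mul, norm_mul, norm_pow, norm_pow,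
    norm_one_sub_conj_mul_of_norm_eq_one hζ, hζ, h1, one_mul, poissonKernel]
  simp only [sub_zero, hζ, one_pow]
  have h3 : 0 ≤ 1 - ‖z‖ ^ 2 := h1 ▸ norm_nonneg _
  calc _ ≤ (1 - ‖z‖ ^ 2) * (2 * ‖ζ - z‖) / (‖ζ - z‖ ^ 2 * ‖ζ - z‖ ^ 2) := by gcongr
    _ = _ := by field_simp

/-- The first term of the kernel is Cauchy's formula for the derivative. The second is holomorphic
in `ζ` and vanishes at `0`, so its product with `F` has mean zero. Cauchy's formula is obtained by
differentiating the Herglotz integral, which equals `2 F - F 0`. -/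
lemma deriv_eq_circleAverage_derivKernel {F : ℂ → ℂ} (hF : DiffContOnCl ℂ F (ball 0 1)) {z : ℂ}
    (hz : z ∈ ball (0 : ℂ) 1) :
    deriv F z = Real.circleAverage (fun ζ => derivKernel z ζ * F ζ) 0 1 := by
  have hz1 : ‖z‖ < 1 := by simpa using hz
  have hFs : ContinuousOn F (sphere 0 1) :=
    hF.continuousOn.mono (by rw [closure_ball _ one_ne_zero]; exact sphere_subset_closedBall)
  have hFi : CircleIntegrable F 0 1 := hFs.circleIntegrable zero_le_one
  have hne : ∀ w ∈ ball (0 : ℂ) 1, ∀ ζ ∈ sphere (0 : ℂ) 1, ζ - w ≠ 0 := by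
    intro w hw ζ hζ h
    rw [sub_eq_zero] at h
    rw [h] at hζ
    simp only [mem_ball_zero_iff, mem_sphere_zero_iff_norm] at hw hζ
    linarith
  have h1 := hasDerivAt_circleAverage_herglotzRieszKernel_smul hFi hz
  have h2 : ∀ w ∈ ball (0 : ℂ) 1,
      Real.circleAverage (fun ζ => herglotzRieszKernel 0 w ζ • F ζ) 0 1 = 2 * F w - F 0 := by
    intro w hw
    have a1 := DiffContOnCl.circleAverage_smul_div (c := 0) (R := 1) (w := w) (f := F)
      (by simpa using hF) (by simpa using hw)
    have a2 := DiffContOnCl.circleAverage (c := 0) (R := 1) (f := F) (by simpa using hF)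
    have hc : ContinuousOn (fun ζ => ((ζ - 0) / (ζ - w)) • F ζ) (sphere 0 1) :=
      (ContinuousOn.div (by fun_prop) (by fun_prop) (hne w hw)).smul hFs
    rw [← a1, ← a2, ← smul_eq_mul, ← Real.circleAverage_smul,
      ← Real.circleAverage_sub ((hc.const_smul (2 : ℂ)).circleIntegrable zero_le_one) hFi]
    refine Real.circleAverage_congr_sphere fun ζ hζ => ?_
    have := hne w hw ζ (by simpa using hζ)
    simp only [herglotzRieszKernel, smul_eq_mul, sub_zero, Pi.sub_apply, Pi.smul_apply]
    field_simp
    ring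
  have h3 : HasDerivAt (fun w => 2 * F w - F 0) (2 * deriv F z) z :=
    (((hF.differentiableOn.differentiableAt (isOpen_ball.mem_nhds hz)).hasDerivAt.const_mul 2).sub_const _)
  have h4 := h3.unique (h1.congr_of_eventuallyEq
    ((eventually_of_mem (isOpen_ball.mem_nhds hz) h2).mono fun w hw => hw.symm))
  set k : ℂ → ℂ := fun ζ => ζ * (conj z ^ 2 / (1 - conj z * ζ) ^ 2) with hk
  have hkd : DiffContOnCl ℂ k (ball 0 1) := by
    apply DifferentiableOn.diffContOnCl
    rw [closure_ball _ one_ne_zero]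
    refine DifferentiableOn.mul (by fun_prop) (DifferentiableOn.div (by fun_prop) (by fun_prop) ?_)
    intro ζ hζ
    exact pow_ne_zero _ (one_sub_conj_mul_ne_zero hz1 (by simpa using hζ))
  have h5 : Real.circleAverage (k • F) 0 1 = 0 := by
    rw [DiffContOnCl.circleAverage (by rw [abs_one]; exact hkd.smul hF)]
    simp [hk]
  have c1 : ContinuousOn (fun ζ => (2 * ζ / (ζ - z) ^ 2) • F ζ) (sphere 0 1) :=
    (ContinuousOn.div (by fun_prop) (by fun_prop)
      fun ζ hζ => pow_ne_zero _ (hne z hz ζ hζ)).smul hFs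
  have c2 : ContinuousOn (k • F) (sphere 0 1) :=
    (hkd.smul hF).continuousOn.mono
      (by rw [closure_ball _ one_ne_zero]; exact sphere_subset_closedBall)
  have h6 : deriv F z = (2⁻¹ : ℂ) • (2 * deriv F z) - Real.circleAverage (k • F) 0 1 := by
    rw [h5]; simp
  rw [h6, h4, ← Real.circleAverage_smul, ← Real.circleAverage_sub
    ((c1.const_smul (2⁻¹ : ℂ)).circleIntegrable zero_le_one) (c2.circleIntegrable zero_le_one)]
  refine Real.circleAverage_congr_sphere fun ζ hζ => ?_
  simp only [Pi.sub_apply, Pi.smul_apply, smul_eq_mul, Pi.mul_apply, hk, derivKernel]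
  ring

/-- If the boundary function of `F` is differentiable along the circle at `ζ`, then `F'` tends to
that derivative nontangentially. -/
lemma tendsto_deriv_nontangential {F : ℂ → ℂ} (hF : DiffContOnCl ℂ F (ball 0 1)) {ζ c : ℂ}
    (hζ : ‖ζ‖ = 1) (hd : HasDerivWithinAt F c (sphere 0 1) ζ) :
    Tendsto (deriv F) (nontangential ζ) (𝓝 c) := by
  -- Subtracting the first-order expansion at `ζ` leaves a remainder `R` with `R' = F' - c`, small
  -- near `ζ` on the circle. Its kernel integral is split at distance `η` from `ζ`.
  rw [nontangential, tendsto_iSup]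
  intro M
  set R : ℂ → ℂ := fun w => F w - F ζ - c * (w - ζ) with hR
  have hRd : DiffContOnCl ℂ R (ball 0 1) :=
    (hF.sub_const _).sub (Differentiable.diffContOnCl (by fun_prop))
  have hderiv : ∀ z ∈ ball (0 : ℂ) 1, deriv R z = deriv F z - c := by
    intro z hz
    have h1 := (hF.differentiableOn.differentiableAt (isOpen_ball.mem_nhds hz)).hasDerivAt
    have h2 := (h1.sub_const (F ζ)).sub (((hasDerivAt_id z).sub_const ζ).const_mul c)
    exact h2.deriv.trans (by simp)
  have hRs : ContinuousOn R (sphere 0 1) :=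
    hRd.continuousOn.mono (by rw [closure_ball _ one_ne_zero]; exact sphere_subset_closedBall)
  obtain ⟨K, hK⟩ := (isCompact_sphere (0 : ℂ) 1).exists_bound_of_continuousOn hRs
  have hK0 : 0 ≤ K := (norm_nonneg _).trans (hK ζ (by simpa using hζ))
  rcases le_or_gt M 0 with hM | hM
  · have : stolzRegion ζ M = ∅ := by
      ext z
      simp only [stolzRegion, Set.mem_ofPred_eq, Set.mem_empty_iff_false, iff_false, not_and, not_lt]
      intro hz
      exact (mul_nonpos_of_nonpos_of_nonneg hM (by linarith)).trans (norm_nonneg _)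
    rw [this, nhdsWithin_empty]
    exact tendsto_bot
  rw [Metric.tendsto_nhds]
  intro ε hε
  -- The near part is at most `2 δ (1 + M)` times a Poisson integral of total mass `1`, which is `ε
  -- / 2`.
  set δ : ℝ := ε / (4 * (1 + M)) with hδ
  have hδ0 : 0 < δ := by positivity
  have hlit := (hasDerivWithinAt_iff_isLittleO.1 hd).def hδ0
  obtain ⟨η, hη, hη'⟩ := Metric.mem_nhdsWithin_iff.1 hlit
  set D : ℝ := 2 * (1 + M) ^ 3 / η ^ 3 * K with hD
  have htend : Tendsto (fun z : ℂ => D * (1 - ‖z‖ ^ 2)) (𝓝[stolzRegion ζ M] ζ) (𝓝 0) := by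
    have : ContinuousAt (fun z : ℂ => D * (1 - ‖z‖ ^ 2)) ζ := by fun_prop
    have h := this.tendsto
    simp only [hζ, one_pow, sub_self, mul_zero] at h
    exact h.mono_left nhdsWithin_le_nhds
  filter_upwards [self_mem_nhdsWithin, htend.eventually_lt_const (half_pos hε)] with z hz hzD
  have hzb : z ∈ ball (0 : ℂ) 1 := by simpa using hz.1
  rw [dist_eq_norm, ← hderiv z hzb, deriv_eq_circleAverage_derivKernel hRd hzb]
  have hPc := continuousOn_poissonKernel_sphere hzb
  have hbound : ∀ w ∈ sphere (0 : ℂ) |1|, ‖derivKernel z w * R w‖ ≤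
      (2 * δ * (1 + M)) * poissonKernel 0 z w + D * (1 - ‖z‖ ^ 2) := by
    intro w hw
    rw [abs_one] at hw
    have hw1 : ‖w‖ = 1 := by simpa using hw
    have hP := poissonKernel_nonneg hz.1.le hw1
    have hzlt : 0 < 1 - ‖z‖ ^ 2 := by nlinarith [hz.1, norm_nonneg z]
    have hwz1 : 1 - ‖z‖ ≤ ‖w - z‖ := by
      have := norm_sub_norm_le w z
      rwa [hw1] at this
    have hwz : 0 < ‖w - z‖ := by linarith [hz.1]
    -- In the Stolz region `|z - ζ| ≤ M (1 - |z|) ≤ M |w - z|`. This cancels the factor `1 / |w -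
    -- z|` of the kernel bound near `ζ`, and keeps `w` away from `z` far from `ζ`.
    have hwζ : ‖w - ζ‖ ≤ (1 + M) * ‖w - z‖ := by
      have h1 : ‖w - ζ‖ ≤ ‖w - z‖ + ‖z - ζ‖ := norm_sub_le_norm_sub_add_norm_sub _ _ _
      rw [norm_sub_rev z ζ] at h1
      nlinarith [hz.2]
    have hk := norm_derivKernel_le hz.1 hw1
    rw [norm_mul]
    rcases lt_or_ge ‖w - ζ‖ η with hlt | hge
    · have h1 : ‖R w‖ ≤ δ * ‖w - ζ‖ := by
        have := hη' ⟨by simpa [dist_eq_norm] using hlt, hw⟩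
        simpa [hR, mul_comm] using this
      calc ‖derivKernel z w‖ * ‖R w‖
          ≤ (2 * poissonKernel 0 z w / ‖w - z‖) * (δ * ((1 + M) * ‖w - z‖)) := by
            gcongr
            exact h1.trans (by gcongr)
        _ = (2 * δ * (1 + M)) * poissonKernel 0 z w := by field_simp
        _ ≤ _ := by
            have : 0 ≤ D * (1 - ‖z‖ ^ 2) := by positivity
            linarith
    · have h1 : η / (1 + M) ≤ ‖w - z‖ := by
        rw [div_le_iff₀ (by positivity)]
        linarith
      have h2 : 2 * poissonKernel 0 z w / ‖w - z‖ = 2 * (1 - ‖z‖ ^ 2) / ‖w - z‖ ^ 3 := by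
        simp only [poissonKernel, sub_zero, hw1]
        field_simp
      calc ‖derivKernel z w‖ * ‖R w‖
          ≤ (2 * (1 - ‖z‖ ^ 2) / (η / (1 + M)) ^ 3) * K := by
            rw [h2] at hk
            gcongr
            · exact hk.trans (by gcongr)
            · exact hK w hw
        _ = D * (1 - ‖z‖ ^ 2) := by
            rw [hD]; field_simp
        _ ≤ _ := by
            have : 0 ≤ (2 * δ * (1 + M)) * poissonKernel 0 z w := by positivity
            linarith
  have hint : CircleIntegrable
      (fun w => (2 * δ * (1 + M)) * poissonKernel 0 z w + D * (1 - ‖z‖ ^ 2)) 0 1 :=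
    ((hPc.const_smul (2 * δ * (1 + M))).add continuousOn_const).circleIntegrable zero_le_one
  refine (norm_circleAverage_le hint hbound).trans_lt ?_
  have : Real.circleAverage
      (fun w => (2 * δ * (1 + M)) * poissonKernel 0 z w + D * (1 - ‖z‖ ^ 2)) 0 1 =
      2 * δ * (1 + M) + D * (1 - ‖z‖ ^ 2) := by
    change Real.circleAverage ((2 * δ * (1 + M)) • poissonKernel 0 z +
      fun _ => D * (1 - ‖z‖ ^ 2)) 0 1 = _
    rw [Real.circleAverage_add
      ((hPc.const_smul (2 * δ * (1 + M))).circleIntegrable zero_le_one)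
      (continuousOn_const.circleIntegrable zero_le_one), Real.circleAverage_const]
    change Real.circleAverage ((2 * δ * (1 + M)) • poissonKernel 0 z) 0 1 + _ = _
    rw [Real.circleAverage_smul, circleAverage_poissonKernel hzb, smul_eq_mul, mul_one]
  rw [this]
  have h4 : 2 * δ * (1 + M) = ε / 2 := by rw [hδ]; field_simp; norm_num
  linarith

/-- Differentiability in the angular parameter gives differentiability along the circle. -/
lemma hasDerivWithinAt_sphere_of_comp_circleMap {F : ℂ → ℂ} {t₀ : ℝ} {c : ℂ}
    (h : HasDerivAt (fun t : ℝ => F (circleMap 0 1 t)) c t₀) :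
    HasDerivWithinAt F (c / (circleMap 0 1 t₀ * I)) (sphere 0 1) (circleMap 0 1 t₀) := by
  set ζ := circleMap 0 1 t₀ with hζ
  have hζ1 : ‖ζ‖ = 1 := by simp [hζ]
  have hζ0 : ζ ≠ 0 := norm_ne_zero_iff.1 (by rw [hζ1]; exact one_ne_zero)
  have hl : HasDerivAt (fun w => log (w / ζ)) (1 / ζ) ζ := by
    have h1 : HasDerivAt (fun w => w / ζ) (1 / ζ) ζ := (hasDerivAt_id ζ).div_const ζ
    have := h1.clog (by rw [div_self hζ0]; exact one_mem_slitPlane)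
    simpa [div_self hζ0] using this
  -- Local inverse of `circleMap 0 1` sending `ζ` to `t₀`; on the circle `log (w / ζ) = (s w - t₀) *
  -- I`.
  set s : ℂ → ℝ := fun w => t₀ + arg (w / ζ) with hs
  have hs0 : s ζ = t₀ := by simp [hs, div_self hζ0]
  have hsc : Tendsto s (𝓝[sphere 0 1] ζ) (𝓝 t₀) := by
    have h1 : ContinuousAt (fun w => arg (w / ζ)) ζ := by
      refine ContinuousAt.comp (g := arg) (f := fun w => w / ζ) ?_ (by fun_prop)
      rw [div_self hζ0]
      exact continuousAt_arg one_mem_slitPlane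
    have h2 : ContinuousAt s ζ := continuousAt_const.add h1
    have := h2.tendsto
    rw [hs0] at this
    exact this.mono_left nhdsWithin_le_nhds
  have hlog : ∀ w ∈ sphere (0 : ℂ) 1, log (w / ζ) = (s w - t₀ : ℝ) * I := by
    intro w hw
    have hw1 : ‖w‖ = 1 := by simpa using hw
    apply Complex.ext <;> simp [hs, log_re, log_im, hw1, hζ1]
  have hsw : ∀ w ∈ sphere (0 : ℂ) 1, circleMap 0 1 (s w) = w := by
    intro w hw
    have hw1 : ‖w‖ = 1 := by simpa using hw
    have hw0 : w / ζ ≠ 0 := div_ne_zero (norm_ne_zero_iff.1 (by rw [hw1]; exact one_ne_zero)) hζ0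
    have e1 := exp_log hw0
    rw [hlog w hw] at e1
    have e2 : circleMap 0 1 (s w) = circleMap 0 1 t₀ * exp ((s w - t₀ : ℝ) * I) := by
      simp only [circleMap, ofReal_one, one_mul, zero_add, ← exp_add]
      congr 1
      push_cast
      ring
    rw [e2, e1, ← hζ]
    field_simp
  rw [hasDerivWithinAt_iff_isLittleO]
  have h1 := (hasDerivAt_iff_isLittleO.1 h).comp_tendsto hsc
  have hlO := hl.hasDerivWithinAt (s := sphere (0 : ℂ) 1)
  have h2 : (fun w => s w - t₀) =O[𝓝[sphere 0 1] ζ] fun w => w - ζ := by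
    have := hlO.differentiableWithinAt.isBigO_sub
    refine Asymptotics.IsBigO.congr' (f₁ := fun w => ‖log (w / ζ) - log (ζ / ζ)‖) this.norm_left ?_ EventuallyEq.rfl |>.of_norm_left
    filter_upwards [self_mem_nhdsWithin] with w hw
    rw [div_self hζ0, log_one, sub_zero, hlog w hw, norm_mul, norm_I, mul_one, norm_real]
  have h3 := h1.trans_isBigO h2
  have h4 := (hasDerivWithinAt_iff_isLittleO.1 hlO).const_mul_left (c / I)
  refine (h3.add h4).congr' ?_ EventuallyEq.rfl
  filter_upwards [self_mem_nhdsWithin] with w hw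
  simp only [Function.comp_apply, hsw w hw]
  rw [div_self hζ0, log_one, hlog w hw]
  simp only [← hζ, real_smul, smul_eq_mul]
  field_simp
  push_cast
  ring

/-- **Fatou's theorem**: bounded holomorphic functions have nontangential limits almost
everywhere. -/
theorem IsHInfty.exists_tendsto_nontangential {g : ℂ → ℂ} (hg : IsHInfty g) :
    ∀ᵐ t : ℝ, ∃ w : ℂ, Tendsto g (nontangential (circleMap 0 1 t)) (𝓝 w) := by
  obtain ⟨hgd, C, hC⟩ := hg
  -- A primitive of `g` is Lipschitz because `g` is bounded. Its extension is Lipschitz on the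
  -- circle, hence differentiable in the angle almost everywhere.
  obtain ⟨G, hG⟩ := hgd.isExactOn_ball
  have hLip : LipschitzOnWith C.toNNReal G (ball 0 1) := by
    refine Convex.lipschitzOnWith_of_nnnorm_hasDerivWithin_le (𝕜 := ℂ) (convex_ball 0 1)
      (fun z hz => (hG z hz).hasDerivWithinAt) fun z hz => ?_
    rw [← NNReal.coe_le_coe, coe_nnnorm]
    exact (hC z hz).trans (Real.le_coe_toNNReal C)
  obtain ⟨F, hF, hFG⟩ := hLip.extend_finite_dimension
  have hFd : ∀ z ∈ ball (0 : ℂ) 1, HasDerivAt F (g z) z := fun z hz =>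
    (hG z hz).congr_of_eventuallyEq (eventually_of_mem (isOpen_ball.mem_nhds hz) fun w hw => (hFG hw).symm)
  have hFc : DiffContOnCl ℂ F (ball 0 1) :=
    ⟨fun z hz => (hFd z hz).differentiableAt.differentiableWithinAt, hF.continuous.continuousOn⟩
  filter_upwards [(hF.comp (lipschitzWith_circleMap 0 1)).ae_differentiableAt_real] with t ht
  refine ⟨_, (tendsto_deriv_nontangential hFc (by simp)
    (hasDerivWithinAt_sphere_of_comp_circleMap ht.hasDerivAt)).congr' ?_⟩
  filter_upwards [eventually_mem_ball_nontangential _] with z hz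
  exact (hFd z hz).deriv

/-! ### Radial limits and the Poisson formula. -/

lemma continuous_comp_circleMap {E : Type*} [TopologicalSpace E] {g : ℂ → E}
    (hg : ContinuousOn g (ball 0 1)) {r : ℝ} (hr : r ∈ Set.Ioo (0 : ℝ) 1) :
    Continuous fun t => g (circleMap 0 r t) :=
  hg.comp_continuous (continuous_circleMap 0 r) fun t => circleMap_zero_mem_ball hr.1.le hr.2 t

lemma exists_seq_tendsto_nhdsLT_one :
    ∃ r : ℕ → ℝ, (∀ n, r n ∈ Set.Ioo (0 : ℝ) 1) ∧ Tendsto r atTop (𝓝[<] 1) := by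
  obtain ⟨r, _, hr, hr1⟩ := exists_seq_strictMono_tendsto' (zero_lt_one (α := ℝ))
  exact ⟨r, hr, tendsto_nhdsWithin_iff.2 ⟨hr1, Eventually.of_forall fun n => (hr n).2⟩⟩

lemma aestronglyMeasurable_of_radial_limit {E : Type*} [NormedAddCommGroup E] {g : ℂ → E}
    (hg : ContinuousOn g (ball 0 1)) {b : ℝ → E}
    (hb : ∀ᵐ t : ℝ, Tendsto (fun r : ℝ => g (circleMap 0 r t)) (𝓝[<] 1) (𝓝 (b t))) :
    AEStronglyMeasurable b volume := by
  obtain ⟨r, hr, hr1⟩ := exists_seq_tendsto_nhdsLT_one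
  refine aestronglyMeasurable_of_tendsto_ae atTop
    (f := fun n t => g (circleMap 0 (r n) t))
    (fun n => (continuous_comp_circleMap hg (hr n)).aestronglyMeasurable) ?_
  filter_upwards [hb] with t ht
  exact ht.comp hr1

lemma continuous_poissonKernel_circleMap {z : ℂ} (hz : z ∈ ball (0 : ℂ) 1) :
    Continuous fun t => poissonKernel 0 z (circleMap 0 1 t) :=
  (continuousOn_poissonKernel_sphere hz).comp_continuous (continuous_circleMap 0 1)
    fun t => circleMap_mem_sphere 0 zero_le_one t

lemma IsHInfty.intervalIntegrable_of_radial_limit {g : ℂ → ℂ} (hg : IsHInfty g) {b : ℝ → ℂ}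
    (hb : ∀ᵐ t : ℝ, Tendsto (fun r : ℝ => g (circleMap 0 r t)) (𝓝[<] 1) (𝓝 (b t))) :
    IntervalIntegrable b volume 0 (2 * Real.pi) := by
  obtain ⟨hgd, C, hC⟩ := hg
  refine (intervalIntegrable_const (c := C)).mono_fun
    (aestronglyMeasurable_of_radial_limit hgd.continuousOn hb).restrict ?_
  filter_upwards [ae_restrict_of_ae hb] with t ht
  refine (le_of_tendsto ht.norm ?_).trans (le_abs_self C)
  filter_upwards [eventually_mem_Ioo_nhdsLT_one] with r hr
  exact hC _ (circleMap_zero_mem_ball hr.1.le hr.2 t)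

/-- The **Poisson formula** for bounded holomorphic functions in terms of radial limits. -/
theorem IsHInfty.integral_poissonKernel_smul {g : ℂ → ℂ} (hg : IsHInfty g) {b : ℝ → ℂ}
    (hb : ∀ᵐ t : ℝ, Tendsto (fun r : ℝ => g (circleMap 0 r t)) (𝓝[<] 1) (𝓝 (b t)))
    {z : ℂ} (hz : z ∈ ball (0 : ℂ) 1) :
    (2 * Real.pi)⁻¹ • ∫ t in (0 : ℝ)..2 * Real.pi, poissonKernel 0 z (circleMap 0 1 t) • b t =
      g z := by
  obtain ⟨hgd, C, hC⟩ := hg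
  have hPc := continuous_poissonKernel_circleMap hz
  have hz1 : ‖z‖ < 1 := by simpa using hz
  -- The dilates `g (r * ·)` are holomorphic up to the closed disk and satisfy the classical Poisson
  -- formula; dominated convergence passes to `r → 1`.
  have h1 : Tendsto (fun r : ℝ => ∫ t in (0 : ℝ)..2 * Real.pi,
      poissonKernel 0 z (circleMap 0 1 t) • g (circleMap 0 r t)) (𝓝[<] 1)
      (𝓝 (∫ t in (0 : ℝ)..2 * Real.pi, poissonKernel 0 z (circleMap 0 1 t) • b t)) := by
    refine intervalIntegral.tendsto_integral_filter_of_dominated_convergence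
      (fun t => poissonKernel 0 z (circleMap 0 1 t) * C) ?_ ?_ ?_ ?_
    · filter_upwards [eventually_mem_Ioo_nhdsLT_one] with r hr
      exact (hPc.smul (continuous_comp_circleMap hgd.continuousOn hr)).aestronglyMeasurable
    · filter_upwards [eventually_mem_Ioo_nhdsLT_one] with r hr
      refine ae_of_all _ fun t _ => ?_
      have hP := poissonKernel_nonneg (ζ := circleMap 0 1 t) hz1.le (by simp)
      rw [norm_smul, Real.norm_of_nonneg hP]
      gcongr
      exact hC _ (circleMap_zero_mem_ball hr.1.le hr.2 t)
    · exact (hPc.mul continuous_const).intervalIntegrable _ _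
    · filter_upwards [hb] with t ht _
      exact ht.const_smul _
  have h2 : ∀ᶠ r : ℝ in 𝓝[<] 1, (2 * Real.pi)⁻¹ • ∫ t in (0 : ℝ)..2 * Real.pi,
      poissonKernel 0 z (circleMap 0 1 t) • g (circleMap 0 r t) = g (r * z) := by
    filter_upwards [eventually_mem_Ioo_nhdsLT_one] with r hr
    have hd : DiffContOnCl ℂ (fun w => g (r * w)) (ball 0 1) := by
      apply DifferentiableOn.diffContOnCl
      rw [closure_ball _ one_ne_zero]
      refine hgd.comp (by fun_prop) fun w hw => ?_
      simp only [mem_closedBall_zero_iff, mem_ball_zero_iff, norm_mul, norm_real,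
        Real.norm_of_nonneg hr.1.le] at hw ⊢
      nlinarith [hr.1, hr.2]
    have := hd.circleAverage_poissonKernel_smul hz
    rw [← this, Real.circleAverage]
    simp only [Pi.smul_apply', circleMap_zero_eq_mul r]
  have h3 : Tendsto (fun r : ℝ => g (r * z)) (𝓝[<] 1) (𝓝 (g z)) := by
    have hc : ContinuousAt g (((1 : ℝ) : ℂ) * z) := by
      rw [ofReal_one, one_mul]
      exact hgd.continuousOn.continuousAt (isOpen_ball.mem_nhds hz)
    have := ContinuousAt.comp (f := fun r : ℝ => (r : ℂ) * z) (x := 1) hc (by fun_prop)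
    have h := this.tendsto
    simp only [Function.comp_apply, ofReal_one, one_mul] at h
    exact h.mono_left nhdsWithin_le_nhds
  exact tendsto_nhds_unique ((h1.const_smul _).congr' h2) h3

lemma integral_poissonKernel_circleMap {z : ℂ} (hz : z ∈ ball (0 : ℂ) 1) :
    (2 * Real.pi)⁻¹ * ∫ t in (0 : ℝ)..2 * Real.pi, poissonKernel 0 z (circleMap 0 1 t) = 1 :=
  circleAverage_poissonKernel hz

/-! ### Boundary values and size of inner functions. -/

/-- Inner functions have unimodular nontangential limits almost everywhere. -/
lemma IsInner.exists_tendsto_nontangential {f : ℂ → ℂ} (hf : IsInner f) :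
    ∀ᵐ t : ℝ, ∃ w : ℂ, ‖w‖ = 1 ∧ Tendsto f (nontangential (circleMap 0 1 t)) (𝓝 w) := by
  filter_upwards [hf.1.exists_tendsto_nontangential, hf.2] with t ⟨w, hw⟩ h1
  exact ⟨w, tendsto_nhds_unique (hw.comp (tendsto_circleMap_nontangential t)).norm h1, hw⟩

lemma IsInner.exists_boundary_function {f : ℂ → ℂ} (hf : IsInner f) :
    ∃ b : ℝ → ℂ, ∀ᵐ t : ℝ, ‖b t‖ = 1 ∧
      Tendsto (fun r : ℝ => f (circleMap 0 r t)) (𝓝[<] 1) (𝓝 (b t)) := by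
  refine ⟨fun t => limUnder (nontangential (circleMap 0 1 t)) f, ?_⟩
  filter_upwards [hf.exists_tendsto_nontangential] with t ⟨w, hw1, hw⟩
  rw [hw.limUnder_eq]
  exact ⟨hw1, hw.comp (tendsto_circleMap_nontangential t)⟩

lemma IsInner.norm_le_one {f : ℂ → ℂ} (hf : IsInner f) {z : ℂ} (hz : z ∈ ball (0 : ℂ) 1) :
    ‖f z‖ ≤ 1 := by
  obtain ⟨b, hb⟩ := hf.exists_boundary_function
  rw [← hf.1.integral_poissonKernel_smul (hb.mono fun t ht => ht.2) hz, norm_smul,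
    Real.norm_of_nonneg (by positivity)]
  refine le_trans ?_ (integral_poissonKernel_circleMap hz).le
  gcongr
  refine intervalIntegral.norm_integral_le_of_norm_le Real.two_pi_pos.le ?_
    ((continuous_poissonKernel_circleMap hz).intervalIntegrable _ _)
  filter_upwards [hb] with t ht _
  rw [norm_smul, ht.1, mul_one, Real.norm_of_nonneg
    (poissonKernel_nonneg (by simpa using (mem_ball_zero_iff.1 hz).le) (by simp))]

lemma IsInner.norm_lt_one {f : ℂ → ℂ} (hf : IsInner f)
    (hnonconst : ¬ ∃ c : ℂ, ∀ z ∈ ball (0 : ℂ) 1, f z = c) {z : ℂ} (hz : z ∈ ball (0 : ℂ) 1) :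
    ‖f z‖ < 1 := by
  refine lt_of_le_of_ne (hf.norm_le_one hz) fun h => hnonconst ⟨f z, ?_⟩
  refine Complex.eqOn_of_isPreconnected_of_isMaxOn_norm (convex_ball 0 1).isPreconnected
    isOpen_ball hf.1.1 hz fun w hw => ?_
  simpa [h] using hf.norm_le_one hw

/-! ### Nevanlinna functions as quotients of bounded functions. -/

/-- Every real continuous function on the circle is uniformly close to the real part of an entire
function. -/
lemma exists_entire_re_approx {u : ℂ → ℝ} (hu : ContinuousOn u (sphere 0 1)) {ε : ℝ} (hε : 0 < ε) :
    ∃ P : ℂ → ℂ, Differentiable ℂ P ∧ ∀ ζ ∈ sphere (0 : ℂ) 1, |(P ζ).re - u ζ| < ε := by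
  have : Fact (0 < 2 * Real.pi) := ⟨Real.two_pi_pos⟩
  have hcirc : ∀ x : AddCircle (2 * Real.pi), (AddCircle.toCircle x : ℂ) ∈ sphere (0 : ℂ) 1 :=
    fun x => mem_sphere_zero_iff_norm.2 (Circle.norm_coe _)
  have hc : Continuous fun x : AddCircle (2 * Real.pi) => (AddCircle.toCircle x : ℂ) :=
    continuous_subtype_val.comp AddCircle.continuous_toCircle
  let f : C(AddCircle (2 * Real.pi), ℂ) :=
    ⟨fun x => (u (AddCircle.toCircle x) : ℂ),
      continuous_ofReal.comp (hu.comp_continuous hc hcirc)⟩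
  have hspan : ∀ q ∈ Submodule.span ℂ (Set.range (fourier (T := 2 * Real.pi))),
      ∃ P Q : ℂ → ℂ, Differentiable ℂ P ∧ Differentiable ℂ Q ∧
        ∀ x, q x = P (AddCircle.toCircle x) + conj (Q (AddCircle.toCircle x)) := by
    intro q hq
    induction hq using Submodule.span_induction with
    | mem q hq =>
      obtain ⟨n, rfl⟩ := hq
      obtain ⟨m, rfl | rfl⟩ := n.eq_nat_or_neg
      · refine ⟨fun z => z ^ m, 0, by fun_prop, differentiable_zero, fun x => ?_⟩
        simp [fourier_apply, AddCircle.toCircle_nsmul]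
      · refine ⟨0, fun z => z ^ m, differentiable_zero, by fun_prop, fun x => ?_⟩
        rw [fourier_neg]
        simp [fourier_apply, AddCircle.toCircle_nsmul]
    | zero => exact ⟨0, 0, differentiable_zero, differentiable_zero, fun x => by simp⟩
    | add q₁ q₂ _ _ h₁ h₂ =>
      obtain ⟨P₁, Q₁, hP₁, hQ₁, h₁⟩ := h₁
      obtain ⟨P₂, Q₂, hP₂, hQ₂, h₂⟩ := h₂
      refine ⟨P₁ + P₂, Q₁ + Q₂, hP₁.add hP₂, hQ₁.add hQ₂, fun x => ?_⟩
      simp [h₁, h₂]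
      ring
    | smul a q _ h =>
      obtain ⟨P, Q, hP, hQ, h⟩ := h
      refine ⟨a • P, conj a • Q, hP.const_smul a, hQ.const_smul _, fun x => ?_⟩
      simp [h]
      ring
  have hmem : f ∈ (Submodule.span ℂ (Set.range (fourier (T := 2 * Real.pi)))).topologicalClosure := by
    rw [span_fourier_closure_eq_top]; trivial
  rw [← SetLike.mem_coe, Submodule.topologicalClosure_coe] at hmem
  obtain ⟨q, hq, hqd⟩ := Metric.mem_closure_iff.1 hmem ε hε
  obtain ⟨P, Q, hP, hQ, h⟩ := hspan q hq
  -- `P + conj Q` and `P + Q` have the same real part.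
  refine ⟨P + Q, hP.add hQ, fun ζ hζ => ?_⟩
  obtain ⟨x, hx⟩ : ∃ x : AddCircle (2 * Real.pi), (AddCircle.toCircle x : ℂ) = ζ := by
    refine ⟨((arg ζ : ℝ) : AddCircle (2 * Real.pi)), ?_⟩
    rw [AddCircle.toCircle_apply_mk, div_self Real.two_pi_pos.ne', one_mul, Circle.coe_exp]
    have := norm_mul_exp_arg_mul_I ζ
    rwa [mem_sphere_zero_iff_norm.1 hζ, ofReal_one, one_mul] at this
  have h1 : ‖f x - q x‖ < ε := by
    rw [← dist_eq_norm]
    exact (ContinuousMap.dist_apply_le_dist x).trans_lt hqd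
  have h2 : ((P + Q) ζ).re - u ζ = (q x - f x).re := by
    rw [h x, ← hx]
    simp [f]
  rw [h2]
  rw [norm_sub_rev] at h1
  exact (abs_re_le_norm _).trans_lt h1

/-- **Montel's theorem** along an ultrafilter. -/
lemma exists_tendsto_ultrafilter {ι : Type*} (U : Ultrafilter ι) {F : ι → ℂ → ℂ}
    (hd : ∀ i, DiffContOnCl ℂ (F i) (ball 0 1)) (hb : ∀ i, ∀ z ∈ sphere (0 : ℂ) 1, ‖F i z‖ ≤ 1) :
    ∃ G : ℂ → ℂ, DifferentiableOn ℂ G (ball 0 1) ∧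
      ∀ z ∈ ball (0 : ℂ) 1, Tendsto (fun i => F i z) U (𝓝 (G z)) := by
  -- Cauchy's estimates bound the Taylor coefficients by `1`, so each converges along the
  -- ultrafilter by compactness; a geometric series dominates the sums.
  set a : ι → ℕ → ℂ := fun i n => (n.factorial : ℂ)⁻¹ * iteratedDeriv n (F i) 0 with ha
  have ha1 : ∀ i n, ‖a i n‖ ≤ 1 := by
    intro i n
    have := norm_iteratedDeriv_le_of_forall_mem_sphere_norm_le n one_pos (hd i) (hb i)
    rw [one_pow, div_one, mul_one] at this
    rw [ha, norm_mul, norm_inv, norm_natCast, inv_mul_le_iff₀ (by positivity), mul_one]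
    exact this
  have hlim : ∀ n, ∃ α ∈ closedBall (0 : ℂ) 1, Tendsto (fun i => a i n) U (𝓝 α) := fun n =>
    (isCompact_closedBall (0 : ℂ) 1).ultrafilter_le_nhds' (U.map fun i => a i n)
      (Ultrafilter.mem_map.2 (univ_mem' fun i => by simpa using ha1 i n))
  choose α hα hαlim using hlim
  have hα1 : ∀ n, ‖α n‖ ≤ 1 := fun n => by simpa using hα n
  refine ⟨fun z => ∑' n, α n * z ^ n, ?_, ?_⟩
  · intro z hz
    obtain ⟨ρ, hzρ, hρ⟩ := exists_between (mem_ball_zero_iff.1 hz)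
    have hρ0 : 0 ≤ ρ := (norm_nonneg z).trans hzρ.le
    refine ((differentiableOn_tsum_of_summable_norm (F := fun n z => α n * z ^ n)
      (U := ball (0 : ℂ) ρ) (summable_geometric_of_lt_one hρ0 hρ) (fun n => by fun_prop)
      isOpen_ball fun n w hw => ?_).differentiableAt
      (isOpen_ball.mem_nhds (by simpa using hzρ))).differentiableWithinAt
    rw [norm_mul, norm_pow]
    calc ‖α n‖ * ‖w‖ ^ n ≤ 1 * ρ ^ n := by
          gcongr
          · exact hα1 n
          · exact (mem_ball_zero_iff.1 hw).le
      _ = ρ ^ n := one_mul _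
  · intro z hz
    have hz1 := mem_ball_zero_iff.1 hz
    have h1 := tendsto_tsum_of_dominated_convergence (𝓕 := (U : Filter ι))
      (f := fun i n => a i n * z ^ n) (g := fun n => α n * z ^ n) (bound := fun n => ‖z‖ ^ n)
      (summable_geometric_of_lt_one (norm_nonneg z) hz1)
      (fun n => (hαlim n).mul_const _)
      (Eventually.of_forall fun i n => by
        rw [norm_mul, norm_pow]
        exact mul_le_of_le_one_left (by positivity) (ha1 i n))
    refine h1.congr fun i => ?_
    rw [← (hasSum_taylorSeries_on_ball (hd i).differentiableOn hz).tsum_eq]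
    refine tsum_congr fun n => ?_
    simp only [ha, smul_eq_mul, sub_zero]
    ring

lemma norm_le_of_forall_mem_sphere {F : ℂ → ℂ} (hF : DiffContOnCl ℂ F (ball 0 1)) {C : ℝ}
    (h : ∀ z ∈ sphere (0 : ℂ) 1, ‖F z‖ ≤ C) {z : ℂ} (hz : z ∈ ball (0 : ℂ) 1) : ‖F z‖ ≤ C := by
  refine norm_le_of_forall_mem_frontier_norm_le isBounded_ball hF ?_ (subset_closure hz)
  rwa [frontier_ball _ one_ne_zero]

/-- A function of the Nevanlinna class is a quotient of two bounded holomorphic functions. -/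
lemma IsNevanlinna.exists_quotient {f : ℂ → ℂ} (hf : IsNevanlinna f) :
    ∃ A B : ℂ → ℂ, IsHInfty A ∧ DifferentiableOn ℂ B (ball 0 1) ∧
      (∀ z ∈ ball (0 : ℂ) 1, ‖B z‖ ≤ 1) ∧ B 0 ≠ 0 ∧
      ∀ z ∈ ball (0 : ℂ) 1, A z = f z * B z := by
  obtain ⟨hfd, C, hC⟩ := hf
  obtain ⟨r, hr, hr1⟩ := exists_seq_tendsto_nhdsLT_one
  have hmaps : ∀ n, Set.MapsTo (fun z : ℂ => (r n : ℂ) * z) (closedBall 0 1) (ball 0 1) := by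
    intro n z hz
    simp only [mem_closedBall_zero_iff, mem_ball_zero_iff, norm_mul, norm_real,
      Real.norm_of_nonneg (hr n).1.le] at hz ⊢
    nlinarith [(hr n).1, (hr n).2]
  have hdil : ∀ n, DifferentiableOn ℂ (fun z => f (r n * z)) (closedBall 0 1) := fun n =>
    hfd.comp (by fun_prop) (hmaps n)
  have hucont : ∀ n, ContinuousOn (fun ζ => Real.posLog ‖f (r n * ζ)‖) (sphere 0 1) := fun n =>
    Real.continuous_posLog.comp_continuousOn
      ((hdil n).continuousOn.mono sphere_subset_closedBall).norm
  -- Approximating `log⁺ + 1` within `1` puts `Re P` between `log⁺` and `log⁺ + 2`. The lower bound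
  -- makes `exp (-P)` and `f * exp (-P)` at most `1` on the circle; the upper one, with the mean
  -- value property, keeps `exp (-P 0)` away from `0`.
  have happ : ∀ n, ∃ P : ℂ → ℂ, Differentiable ℂ P ∧ ∀ ζ ∈ sphere (0 : ℂ) 1,
      |(P ζ).re - (Real.posLog ‖f (r n * ζ)‖ + 1)| < 1 := fun n =>
    exists_entire_re_approx ((hucont n).add continuousOn_const) one_pos
  choose P hPd hP using happ
  have hP1 : ∀ n, ∀ ζ ∈ sphere (0 : ℂ) 1, Real.posLog ‖f (r n * ζ)‖ ≤ (P n ζ).re := fun n ζ hζ => by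
    have := abs_lt.1 (hP n ζ hζ)
    linarith
  have hP2 : ∀ n, ∀ ζ ∈ sphere (0 : ℂ) 1, (P n ζ).re ≤ Real.posLog ‖f (r n * ζ)‖ + 2 :=
    fun n ζ hζ => by
      have := abs_lt.1 (hP n ζ hζ)
      linarith
  set Bn : ℕ → ℂ → ℂ := fun n z => exp (-P n z)
  set An : ℕ → ℂ → ℂ := fun n z => f (r n * z) * exp (-P n z)
  have hBd : ∀ n, DiffContOnCl ℂ (Bn n) (ball 0 1) := fun n =>
    ((hPd n).neg.cexp).diffContOnCl
  have hAd : ∀ n, DiffContOnCl ℂ (An n) (ball 0 1) := fun n => by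
    refine DiffContOnCl.smul (c := fun z => f (r n * z)) (DifferentiableOn.diffContOnCl ?_) (hBd n)
    rw [closure_ball _ one_ne_zero]
    exact hdil n
  have hB1 : ∀ n, ∀ z ∈ sphere (0 : ℂ) 1, ‖Bn n z‖ ≤ 1 := fun n z hz => by
    simp only [Bn, norm_exp, neg_re, Real.exp_le_one_iff, Left.neg_nonpos_iff]
    exact Real.posLog_nonneg.trans (hP1 n z hz)
  have hA1 : ∀ n, ∀ z ∈ sphere (0 : ℂ) 1, ‖An n z‖ ≤ 1 := fun n z hz => by
    simp only [An, norm_mul, norm_exp, neg_re, Real.exp_neg]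
    rw [← div_eq_mul_inv, div_le_one (Real.exp_pos _)]
    refine (Real.le_exp_log _).trans (Real.exp_le_exp.2 ((le_max_right _ _).trans (hP1 n z hz)))
  have hB0 : ∀ n, Real.exp (-(C + 2)) ≤ ‖Bn n 0‖ := fun n => by
    simp only [Bn, norm_exp, neg_re]
    refine Real.exp_le_exp.2 (neg_le_neg ?_)
    have h1 : Real.circleAverage (fun ζ => (P n ζ).re) 0 1 = (P n 0).re := by
      have hd : DiffContOnCl ℂ (P n) (ball 0 |1|) := (hPd n).diffContOnCl
      rw [← hd.circleAverage]
      exact reCLM.circleAverage_comp_comm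
        ((hPd n).continuous.continuousOn.circleIntegrable zero_le_one)
    rw [← h1]
    have hi : CircleIntegrable (fun ζ => Real.posLog ‖f (r n * ζ)‖) 0 1 :=
      (hucont n).circleIntegrable zero_le_one
    have hi2 : CircleIntegrable (fun _ => (2 : ℝ)) 0 1 :=
      continuousOn_const.circleIntegrable zero_le_one
    calc Real.circleAverage (fun ζ => (P n ζ).re) 0 1
        ≤ Real.circleAverage (fun ζ => Real.posLog ‖f (r n * ζ)‖ + 2) 0 1 := by
          refine Real.circleAverage_mono
            ((continuous_re.comp (hPd n).continuous).continuousOn.circleIntegrable zero_le_one)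
            (hi.add hi2) fun ζ hζ => hP2 n ζ (by simpa using hζ)
      _ = Real.circleAverage (fun ζ => Real.posLog ‖f ζ‖) 0 (r n) + 2 := by
          rw [Real.circleAverage_fun_add hi hi2, Real.circleAverage_const]
          simp only [Real.circleAverage, circleMap_zero_eq_mul (r n)]
      _ ≤ C + 2 := by linarith [hC (r n) (hr n)]
  -- One ultrafilter for both families, so that `An = f (r n * ·) * Bn` survives in the limit.
  let U : Ultrafilter ℕ := Filter.hyperfilter ℕ
  have hU : (U : Filter ℕ) ≤ atTop := Nat.hyperfilter_le_atTop
  obtain ⟨A, hAdiff, hAlim⟩ := exists_tendsto_ultrafilter U hAd hA1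
  obtain ⟨B, hBdiff, hBlim⟩ := exists_tendsto_ultrafilter U hBd hB1
  have h0 : (0 : ℂ) ∈ ball (0 : ℂ) 1 := by simp
  refine ⟨A, B, ⟨hAdiff, 1, fun z hz => ?_⟩, hBdiff, fun z hz => ?_, ?_, fun z hz => ?_⟩
  · exact le_of_tendsto (hAlim z hz).norm
      (Eventually.of_forall fun n => norm_le_of_forall_mem_sphere (hAd n) (hA1 n) hz)
  · exact le_of_tendsto (hBlim z hz).norm
      (Eventually.of_forall fun n => norm_le_of_forall_mem_sphere (hBd n) (hB1 n) hz)
  · have := ge_of_tendsto (hBlim 0 h0).norm (Eventually.of_forall hB0)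
    exact norm_pos_iff.1 ((Real.exp_pos _).trans_le this)
  · refine tendsto_nhds_unique (hAlim z hz) (Tendsto.mul ?_ (hBlim z hz))
    have hc : ContinuousAt f (((1 : ℝ) : ℂ) * z) := by
      rw [ofReal_one, one_mul]
      exact hfd.continuousOn.continuousAt (isOpen_ball.mem_nhds hz)
    have h := (ContinuousAt.comp (f := fun r : ℝ => (r : ℂ) * z) (x := 1) hc (by fun_prop)).tendsto
    simp only [Function.comp_apply, ofReal_one, one_mul] at h
    exact h.comp ((hr1.mono_right nhdsWithin_le_nhds).mono_left hU)

/-! ### Nonvanishing of radial limits and Fatou's theorem for the Nevanlinna class. -/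

/-- Fatou's lemma for averages over circles. -/
lemma lintegral_liminf_le_of_circleAverage_le {u : ℂ → ℝ} {r : ℕ → ℝ} {K : ℝ}
    (hi : ∀ n, CircleIntegrable u 0 (r n)) (hnn : ∀ n t, 0 ≤ u (circleMap 0 (r n) t))
    (hK : ∀ n, Real.circleAverage u 0 (r n) ≤ K) :
    ∫⁻ t in Set.uIoc 0 (2 * Real.pi), liminf (fun n => ENNReal.ofReal (u (circleMap 0 (r n) t))) atTop ≤
      ENNReal.ofReal (2 * Real.pi * K) := by
  have hint : ∀ n, IntegrableOn (fun t => u (circleMap 0 (r n) t)) (Set.uIoc 0 (2 * Real.pi)) :=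
    fun n => intervalIntegrable_iff.1 (hi n)
  refine (lintegral_liminf_le' fun n => (hint n).aestronglyMeasurable.aemeasurable.ennreal_ofReal).trans ?_
  refine (liminf_le_liminf (v := fun _ => ENNReal.ofReal (2 * Real.pi * K))
    (Eventually.of_forall fun n => ?_)).trans (liminf_const _).le
  rw [← ofReal_integral_eq_lintegral_ofReal (hint n) (ae_of_all _ (hnn n))]
  refine ENNReal.ofReal_le_ofReal ?_
  have := hK n
  rw [Real.circleAverage, intervalIntegral.integral_of_le Real.two_pi_pos.le, smul_eq_mul,
    inv_mul_le_iff₀ Real.two_pi_pos] at this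
  rwa [Set.uIoc_of_le Real.two_pi_pos.le]

/-- **Jensen's inequality** for a holomorphic function on a disk. -/
lemma log_norm_le_circleAverage {B : ℂ → ℂ} {r : ℝ} (hr : 0 < r)
    (hB : AnalyticOnNhd ℂ B (closedBall 0 r)) (h0 : B 0 ≠ 0) :
    Real.log ‖B 0‖ ≤ Real.circleAverage (fun z => Real.log ‖B z‖) 0 r := by
  have hB' : AnalyticOnNhd ℂ B (closedBall 0 |r|) := by rwa [abs_of_pos hr]
  rw [hB'.circleAverage_log_norm hr.ne' h0]
  -- Each zero `u` contributes its multiplicity times `log (r / |u|) ≥ 0` in Jensen's formula; for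
  -- `u = 0` the logarithm is `0` by convention.
  refine le_add_of_nonneg_left (finsum_nonneg fun u => ?_)
  by_cases hu : u ∈ closedBall (0 : ℂ) |r|
  · refine mul_nonneg ?_ ?_
    · exact_mod_cast (MeromorphicOn.AnalyticOnNhd.divisor_nonneg hB') u
    · rcases eq_or_ne u 0 with rfl | hu0
      · simp
      · refine Real.log_nonneg ?_
        rw [zero_sub, norm_neg, ← div_eq_mul_inv, one_le_div (norm_pos_iff.2 hu0)]
        simpa [abs_of_pos hr] using hu
  · rw [Function.locallyFinsuppWithin.apply_eq_zero_of_notMem _ hu]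
    simp

/-- Radial limits of a bounded holomorphic function that is not identically zero are nonzero
almost everywhere. -/
lemma ae_radial_limit_ne_zero {B : ℂ → ℂ} (hB : DifferentiableOn ℂ B (ball 0 1))
    (hB1 : ∀ z ∈ ball (0 : ℂ) 1, ‖B z‖ ≤ 1) (h0 : B 0 ≠ 0) :
    ∀ᵐ t : ℝ, ∀ w : ℂ, Tendsto (fun r : ℝ => B (circleMap 0 r t)) (𝓝[<] 1) (𝓝 w) → w ≠ 0 := by
  refine ae_of_ae_restrict_period (fun t n h => ?_) ?_
  · simpa only [circleMap_add_int_mul_two_pi] using h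
  obtain ⟨r, hr, hr1⟩ := exists_seq_tendsto_nhdsLT_one
  have han : AnalyticOnNhd ℂ B (ball 0 1) := hB.analyticOnNhd isOpen_ball
  have hanr : ∀ n, AnalyticOnNhd ℂ B (closedBall 0 (r n)) := fun n =>
    han.mono (closedBall_subset_ball (hr n).2)
  have hci : ∀ n, CircleIntegrable (fun z => Real.log ‖B z‖) 0 (r n) := fun n =>
    MeromorphicOn.circleIntegrable_log_norm fun z hz =>
      (hanr n z (sphere_subset_closedBall (by rwa [abs_of_pos (hr n).1] at hz))).meromorphicAt
  -- Jensen bounds the means of `-log |B|`, so by Fatou's lemma its liminf along `r n` is finite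
  -- almost everywhere. A zero radial limit would make it infinite.
  have hfat := lintegral_liminf_le_of_circleAverage_le (u := fun z => -Real.log ‖B z‖) (r := r)
    (K := -Real.log ‖B 0‖) (fun n => (hci n).neg)
    (fun n t => neg_nonneg.2 (Real.log_nonpos (norm_nonneg _)
      (hB1 _ (circleMap_zero_mem_ball (hr n).1.le (hr n).2 t))))
    (fun n => by
      have h1 := log_norm_le_circleAverage (hr n).1 (hanr n) h0
      have h2 : Real.circleAverage (fun z => -Real.log ‖B z‖) 0 (r n) =
          -Real.circleAverage (fun z => Real.log ‖B z‖) 0 (r n) := by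
        simp [Real.circleAverage]
      rw [h2]
      exact neg_le_neg h1)
  have hmeas : AEMeasurable (fun t => liminf (fun n =>
      ENNReal.ofReal (-Real.log ‖B (circleMap 0 (r n) t)‖)) atTop)
      (volume.restrict (Set.uIoc 0 (2 * Real.pi))) := by
    refine Measurable.aemeasurable (Measurable.liminf fun n => ?_)
    have := (continuous_comp_circleMap hB.continuousOn (hr n)).measurable
    exact (Real.measurable_log.comp this.norm).neg.ennreal_ofReal
  have hfin := ae_lt_top' hmeas (hfat.trans_lt ENNReal.ofReal_lt_top).ne
  -- Since `Real.log 0 = 0`, zeros of `B` at the sampled points would hide the blow-up; for almost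
  -- every `t` there are none.
  have hne : ∀ᵐ t ∂volume.restrict (Set.uIoc 0 (2 * Real.pi)), ∀ n,
      B (circleMap 0 (r n) t) ≠ 0 := by
    refine ae_all_iff.2 fun n => ?_
    have h1 : B ⁻¹' {0}ᶜ ∈ codiscreteWithin (ball (0 : ℂ) 1) :=
      han.preimage_zero_mem_codiscreteWithin (x := 0) h0 (by simp)
        ((convex_ball 0 1).isConnected ⟨0, by simp⟩)
    have h2 : B ⁻¹' {0}ᶜ ∈ codiscreteWithin (sphere (0 : ℂ) |r n|) := by
      refine codiscreteWithin_mono ?_ h1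
      rw [abs_of_pos (hr n).1]
      exact sphere_subset_closedBall.trans (closedBall_subset_ball (hr n).2)
    have h3 := circleMap_preimage_codiscrete (hr n).1.ne' h2
    exact ae_restrict_le_codiscreteWithin measurableSet_uIoc
      (codiscreteWithin_mono (Set.subset_univ _) h3)
  filter_upwards [hfin, hne] with t ht hn w hw hw0
  refine ht.ne ?_
  have h1 : Tendsto (fun n => ‖B (circleMap 0 (r n) t)‖) atTop (𝓝[>] 0) := by
    refine tendsto_nhdsWithin_iff.2 ⟨?_, Eventually.of_forall fun n => norm_pos_iff.2 (hn n)⟩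
    have := (hw.comp hr1).norm
    rwa [hw0, norm_zero] at this
  have h2 : Tendsto (fun n => -Real.log ‖B (circleMap 0 (r n) t)‖) atTop atTop :=
    tendsto_neg_atBot_atTop.comp (Real.tendsto_log_nhdsGT_zero.comp h1)
  exact (ENNReal.tendsto_ofReal_atTop.comp h2).liminf_eq

/-- **Fatou's theorem** for the Nevanlinna class. -/
theorem IsNevanlinna.exists_tendsto_nontangential {f : ℂ → ℂ} (hf : IsNevanlinna f) :
    ∀ᵐ t : ℝ, ∃ w : ℂ, Tendsto f (nontangential (circleMap 0 1 t)) (𝓝 w) := by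
  obtain ⟨A, B, hA, hB, hB1, h0, hAB⟩ := hf.exists_quotient
  filter_upwards [hA.exists_tendsto_nontangential,
    IsHInfty.exists_tendsto_nontangential ⟨hB, 1, hB1⟩, ae_radial_limit_ne_zero hB hB1 h0]
    with t ⟨a, ha⟩ ⟨b, hb⟩ hne
  have hb0 : b ≠ 0 := hne b (hb.comp (tendsto_circleMap_nontangential t))
  refine ⟨a / b, (ha.div hb hb0).congr' ?_⟩
  filter_upwards [eventually_mem_ball_nontangential _, hb.eventually_ne hb0] with z hz hzB
  rw [Pi.div_apply, hAB z hz, mul_div_cancel_right₀ _ hzB]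

/-! ### Julia's inequality at the boundary. -/

/-- A form of **Julia's inequality**, bounding the derivative at a boundary point from below. -/
lemma julia_inequality {f : ℂ → ℂ} (hf : DifferentiableOn ℂ f (ball 0 1))
    (hf1 : ∀ z ∈ ball (0 : ℂ) 1, ‖f z‖ < 1) {t : ℝ} {η w : ℂ} (hη : ‖η‖ = 1)
    (hlim : Tendsto (fun r : ℝ => f (circleMap 0 r t)) (𝓝[<] 1) (𝓝 η))
    (hderiv : Tendsto (fun r : ℝ => deriv f (circleMap 0 r t)) (𝓝[<] 1) (𝓝 w))
    {z : ℂ} (hz : z ∈ ball (0 : ℂ) 1) :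
    (1 - ‖z‖ ^ 2) * ‖1 - conj (f z) * η‖ ^ 2 ≤
      (1 - ‖f z‖ ^ 2) * ‖1 - conj z * circleMap 0 1 t‖ ^ 2 * ‖w‖ := by
  set ζ := circleMap 0 1 t with hζ
  have hζ1 : ‖ζ‖ = 1 := by simp [hζ]
  set v : ℝ → ℂ := Function.update (fun r : ℝ => f (circleMap 0 r t)) 1 η with hv
  have hv1 : v 1 = η := Function.update_self _ _ _
  have hvr : ∀ r, r < 1 → v r = f (circleMap 0 r t) := fun r hr => Function.update_of_ne hr.ne _ _
  have hvlim : Tendsto v (𝓝[<] 1) (𝓝 η) :=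
    hlim.congr' (eventually_mem_nhdsWithin.mono fun r hr => (hvr r hr).symm)
  have hvd : ∀ r ∈ Set.Ioo (0 : ℝ) 1, HasDerivAt v (deriv f (circleMap 0 r t) * ζ) r := by
    intro r hr
    have h1 : HasDerivAt f (deriv f (r * ζ)) (r * ζ) := by
      rw [hζ, ← circleMap_zero_eq_mul]
      exact (hf.differentiableAt
        (isOpen_ball.mem_nhds (circleMap_zero_mem_ball hr.1.le hr.2 t))).hasDerivAt
    have h2 : HasDerivAt (fun s : ℝ => (s : ℂ) * ζ) ζ r := by
      simpa using (ofRealCLM.hasDerivAt (x := r)).mul_const ζ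
    have h3 := h1.comp_of_eq r h2 rfl
    rw [hζ, ← circleMap_zero_eq_mul] at h3
    refine h3.congr_of_eventuallyEq ?_
    filter_upwards [Iio_mem_nhds hr.2] with s hs
    rw [hvr s hs, circleMap_zero_eq_mul]
    rfl
  -- A limit of the derivative along the radius is a one-sided derivative at the endpoint, whence
  -- `|η - v r| / (1 - r) → |w|`.
  have hvderiv : HasDerivWithinAt v (w * ζ) (Set.Iic 1) 1 := by
    refine hasDerivWithinAt_Iic_of_tendsto_deriv (s := Set.Ioo 0 1)
      (fun r hr => (hvd r hr).differentiableAt.differentiableWithinAt) ?_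
      (Ioo_mem_nhdsLT one_pos) ?_
    · have := hvlim.mono_left (nhdsWithin_mono 1 (fun r (hr : r ∈ Set.Ioo (0 : ℝ) 1) => hr.2))
      rwa [ContinuousWithinAt, hv1]
    · refine (hderiv.mul_const ζ).congr' ?_
      filter_upwards [eventually_mem_Ioo_nhdsLT_one] with r hr
      exact (hvd r hr).deriv.symm
  have hslope : Tendsto (fun r : ℝ => ‖η - v r‖ / (1 - r)) (𝓝[<] 1) (𝓝 ‖w‖) := by
    have h1 := ((hasDerivWithinAt_iff_tendsto_slope.1 hvderiv).mono_left
      (nhdsWithin_mono 1 (fun r (hr : r < 1) => ⟨hr.le, hr.ne⟩))).norm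
    rw [norm_mul, hζ1, mul_one] at h1
    refine h1.congr' ?_
    filter_upwards [self_mem_nhdsWithin] with r hr
    rw [slope_def_module, norm_smul, hv1, norm_inv, Real.norm_eq_abs, abs_sub_comm,
      abs_of_pos (sub_pos.2 hr), norm_sub_rev, inv_mul_eq_div]
  have hcirc : Tendsto (fun r : ℝ => circleMap 0 r t) (𝓝[<] 1) (𝓝 ζ) := by
    have : Continuous fun r : ℝ => circleMap 0 r t := by unfold circleMap; fun_prop
    exact (this.tendsto 1).mono_left nhdsWithin_le_nhds
  have hid : Tendsto (fun r : ℝ => r) (𝓝[<] 1) (𝓝 1) := tendsto_id.mono_left nhdsWithin_le_nhds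
  have hL : Tendsto (fun r : ℝ => (1 - ‖z‖ ^ 2) * ‖1 - conj (f z) * v r‖ ^ 2) (𝓝[<] 1)
      (𝓝 ((1 - ‖z‖ ^ 2) * ‖1 - conj (f z) * η‖ ^ 2)) :=
    (((hvlim.const_mul _).const_sub _).norm.pow 2).const_mul _
  -- This is the Schwarz–Pick bound divided by `1 - r²`, with `1 - |v r|²` replaced by the larger
  -- `|η - v r| (1 + |v r|)`.
  have hR : Tendsto (fun r : ℝ => (1 - ‖f z‖ ^ 2) * ‖1 - conj z * circleMap 0 r t‖ ^ 2 *
      (‖η - v r‖ / (1 - r) * ((1 + ‖v r‖) / (1 + r)))) (𝓝[<] 1)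
      (𝓝 ((1 - ‖f z‖ ^ 2) * ‖1 - conj z * ζ‖ ^ 2 * (‖w‖ * ((1 + ‖η‖) / (1 + 1))))) :=
    ((((hcirc.const_mul _).const_sub _).norm.pow 2).const_mul _).mul
      (hslope.mul ((hvlim.norm.const_add 1).div (hid.const_add 1) (by norm_num)))
  rw [hη, div_self (by norm_num : (1 : ℝ) + 1 ≠ 0), mul_one] at hR
  refine le_of_tendsto_of_tendsto hL hR ?_
  filter_upwards [eventually_mem_Ioo_nhdsLT_one] with r hr
  have hu := circleMap_zero_mem_ball hr.1.le hr.2 t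
  have hsp := schwarz_pick hf hf1 hz hu
  rw [← hvr r hr.2, norm_circleMap_zero, abs_of_pos hr.1] at hsp
  have hr2 : 0 < 1 - r := by linarith [hr.2]
  have hr3 : 0 < 1 + r := by linarith [hr.1]
  have h1 : 1 - ‖v r‖ ^ 2 ≤ ‖η - v r‖ * (1 + ‖v r‖) := by
    have := norm_sub_norm_le η (v r)
    rw [hη] at this
    nlinarith [norm_nonneg (v r)]
  have hfz : 0 ≤ 1 - ‖f z‖ ^ 2 := by nlinarith [hf1 z hz, norm_nonneg (f z)]
  have h2 : (1 - ‖z‖ ^ 2) * (1 - r ^ 2) * ‖1 - conj (f z) * v r‖ ^ 2 ≤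
      (1 - ‖f z‖ ^ 2) * (‖η - v r‖ * (1 + ‖v r‖)) * ‖1 - conj z * circleMap 0 r t‖ ^ 2 :=
    hsp.trans (by gcongr)
  have e : (1 - ‖f z‖ ^ 2) * ‖1 - conj z * circleMap 0 r t‖ ^ 2 *
      (‖η - v r‖ / (1 - r) * ((1 + ‖v r‖) / (1 + r))) =
      (1 - ‖f z‖ ^ 2) * (‖η - v r‖ * (1 + ‖v r‖)) * ‖1 - conj z * circleMap 0 r t‖ ^ 2 /
        (1 - r ^ 2) := by
    rw [show 1 - r ^ 2 = (1 - r) * (1 + r) by ring]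
    field_simp
  rw [e, le_div_iff₀ (by nlinarith)]
  linarith

/-! ### Integrability of `log |θ'|` and the outer function estimate. -/

/-- The values of `1 - conj a * f` lie within `|a| < 1` of `1`, so the principal logarithm is
holomorphic and bounded there. This makes the Poisson formula available for the logarithm of Julia's
inequality. -/
lemma isHInfty_log_one_sub_conj_mul {f : ℂ → ℂ} (hf : DifferentiableOn ℂ f (ball 0 1))
    (hf1 : ∀ z ∈ ball (0 : ℂ) 1, ‖f z‖ ≤ 1) {a : ℂ} (ha : ‖a‖ < 1) :
    IsHInfty fun z => log (1 - conj a * f z) := by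
  have hs : ∀ z ∈ ball (0 : ℂ) 1, ‖-(conj a * f z)‖ ≤ ‖a‖ := by
    intro z hz
    rw [norm_neg, norm_mul, RCLike.norm_conj]
    exact mul_le_of_le_one_right (norm_nonneg _) (hf1 z hz)
  refine ⟨?_, ‖a‖ ^ 2 * (1 - ‖a‖)⁻¹ / 2 + ‖a‖, fun z hz => ?_⟩
  · refine DifferentiableOn.clog ((hf.const_mul _).const_sub _) fun z hz => ?_
    rw [sub_eq_add_neg]
    exact mem_slitPlane_of_norm_lt_one ((hs z hz).trans_lt ha)
  · have h := hs z hz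
    beta_reduce
    rw [sub_eq_add_neg 1 (conj a * f z)]
    refine (norm_log_one_add_le (h.trans_lt ha)).trans ?_
    have h1 : (1 - ‖-(conj a * f z)‖)⁻¹ ≤ (1 - ‖a‖)⁻¹ :=
      inv_anti₀ (by linarith) (by linarith)
    have : 0 < 1 - ‖a‖ := by linarith
    have h3 : 0 ≤ (1 - ‖-(conj a * f z)‖)⁻¹ := inv_nonneg.2 (by linarith)
    gcongr

lemma tendsto_log_one_sub_conj_mul {ι : Type*} {l : Filter ι} {u : ι → ℂ} {η a : ℂ}
    (hu : Tendsto u l (𝓝 η)) (hη : ‖η‖ = 1) (ha : ‖a‖ < 1) :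
    Tendsto (fun i => log (1 - conj a * u i)) l (𝓝 (log (1 - conj a * η))) := by
  refine ((hu.const_mul _).const_sub _).clog ?_
  rw [sub_eq_add_neg]
  refine mem_slitPlane_of_norm_lt_one ?_
  rwa [norm_neg, norm_mul, RCLike.norm_conj, hη, mul_one]

lemma re_log_one_sub_conj_mul_self {a : ℂ} (ha : ‖a‖ < 1) :
    (log (1 - conj a * a)).re = Real.log (1 - ‖a‖ ^ 2) := by
  have : conj a * a = ((‖a‖ ^ 2 : ℝ) : ℂ) := by
    rw [← normSq_eq_norm_sq, mul_comm, mul_conj]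
  rw [log_re, this, ← ofReal_one, ← ofReal_sub, norm_real, Real.norm_of_nonneg]
  nlinarith [norm_nonneg a]

/-- For nonconstant inner `f` with `f'` in the Nevanlinna class, the boundary values of `f` and
`f'` exist almost everywhere and satisfy Julia's inequality. -/
lemma IsInner.ae_boundary_deriv {θ : ℂ → ℂ} (hθ : IsInner θ)
    (hnonconst : ¬ ∃ c : ℂ, ∀ z ∈ ball (0 : ℂ) 1, θ z = c) (hN : IsNevanlinna (deriv θ)) :
    ∃ b : ℝ → ℂ, ∀ᵐ t : ℝ, ‖b t‖ = 1 ∧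
      Tendsto (fun r : ℝ => θ (circleMap 0 r t)) (𝓝[<] 1) (𝓝 (b t)) ∧
      Tendsto (deriv θ) (nontangential (circleMap 0 1 t))
        (𝓝 (boundaryValue (deriv θ) (circleMap 0 1 t))) ∧
      ∀ z ∈ ball (0 : ℂ) 1, (1 - ‖z‖ ^ 2) * ‖1 - conj (θ z) * b t‖ ^ 2 ≤
        (1 - ‖θ z‖ ^ 2) * ‖1 - conj z * circleMap 0 1 t‖ ^ 2 *
          ‖boundaryValue (deriv θ) (circleMap 0 1 t)‖ := by
  obtain ⟨b, hb⟩ := hθ.exists_boundary_function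
  refine ⟨b, ?_⟩
  filter_upwards [hb, hN.exists_tendsto_nontangential] with t ⟨hb1, hbt⟩ ⟨w, hw⟩
  rw [boundaryValue, hw.limUnder_eq]
  exact ⟨hb1, hbt, hw, fun z hz => julia_inequality hθ.1.1
    (fun z hz => hθ.norm_lt_one hnonconst hz) hb1 hbt
    (hw.comp (tendsto_circleMap_nontangential t)) hz⟩

/-- The boundary values of a function of the Nevanlinna class have integrable `log⁺`. -/
lemma IsNevanlinna.integrableOn_posLog {f : ℂ → ℂ} (hf : IsNevanlinna f) {b : ℝ → ℂ}
    (hb : ∀ᵐ t : ℝ, Tendsto (fun r : ℝ => f (circleMap 0 r t)) (𝓝[<] 1) (𝓝 (b t))) :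
    IntegrableOn (fun t => Real.posLog ‖b t‖) (Set.uIoc 0 (2 * Real.pi)) := by
  obtain ⟨hfd, C, hC⟩ := hf
  obtain ⟨r, hr, hr1⟩ := exists_seq_tendsto_nhdsLT_one
  have hcont : ∀ n, Continuous fun t => Real.posLog ‖f (circleMap 0 (r n) t)‖ := fun n =>
    Real.continuous_posLog.comp (continuous_comp_circleMap hfd.continuousOn (hr n)).norm
  have hfat := lintegral_liminf_le_of_circleAverage_le (u := fun z => Real.posLog ‖f z‖) (r := r)
    (fun n => (hcont n).intervalIntegrable _ _) (fun n t => Real.posLog_nonneg)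
    (fun n => hC (r n) (hr n))
  refine ⟨Real.continuous_posLog.comp_aestronglyMeasurable
    (aestronglyMeasurable_of_radial_limit hfd.continuousOn hb).norm.restrict, ?_⟩
  rw [hasFiniteIntegral_iff_ofReal (ae_of_all _ fun t => Real.posLog_nonneg)]
  refine lt_of_eq_of_lt (lintegral_congr_ae ?_) (hfat.trans_lt ENNReal.ofReal_lt_top)
  filter_upwards [ae_restrict_of_ae hb] with t ht
  refine (Tendsto.liminf_eq ?_).symm
  exact ENNReal.tendsto_ofReal
    ((Real.continuous_posLog.tendsto _).comp (ht.comp hr1).norm)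

lemma one_sub_norm_sq_pos {a : ℂ} (ha : ‖a‖ < 1) : 0 < 1 - ‖a‖ ^ 2 := by
  nlinarith [norm_nonneg a]

lemma norm_one_sub_conj_mul_pos {a b : ℂ} (ha : ‖a‖ < 1) (hb : ‖b‖ = 1) :
    0 < ‖1 - conj a * b‖ :=
  norm_pos_iff.2 (one_sub_conj_mul_ne_zero ha hb.le)

lemma IsInner.circleIntegrable_log_norm_boundaryValue_deriv {θ : ℂ → ℂ} (hθ : IsInner θ)
    (hnonconst : ¬ ∃ c : ℂ, ∀ z ∈ ball (0 : ℂ) 1, θ z = c) (hN : IsNevanlinna (deriv θ)) :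
    CircleIntegrable (fun ζ => Real.log ‖boundaryValue (deriv θ) ζ‖) 0 1 := by
  obtain ⟨b, hb⟩ := hθ.ae_boundary_deriv hnonconst hN
  have h0 : (0 : ℂ) ∈ ball (0 : ℂ) 1 := by simp
  have ha := hθ.norm_lt_one hnonconst h0
  set D : ℂ → ℂ := boundaryValue (deriv θ)
  have hrad : ∀ᵐ t : ℝ, Tendsto (fun r : ℝ => deriv θ (circleMap 0 r t)) (𝓝[<] 1)
      (𝓝 (D (circleMap 0 1 t))) :=
    hb.mono fun t ht => ht.2.2.1.comp (tendsto_circleMap_nontangential t)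
  have hmeas := aestronglyMeasurable_of_radial_limit hN.1.continuousOn hrad
  have hpos := hN.integrableOn_posLog hrad
  -- The lower bound for `|θ'|` given by Julia's inequality at `z = 0` and `|1 - conj (θ 0) * b t| ≥
  -- 1 - |θ 0|`. Thus `log |θ'|` lies between `log c` and `log⁺ |θ'|`.
  set c : ℝ := (1 - ‖θ 0‖) ^ 2 / (1 - ‖θ 0‖ ^ 2)
  have hc : 0 < c := div_pos (by have := sub_pos.2 ha; positivity) (one_sub_norm_sq_pos ha)
  have hconst : IntegrableOn (fun _ => |Real.log c|) (Set.uIoc 0 (2 * Real.pi)) :=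
    intervalIntegrable_iff.1 intervalIntegrable_const
  refine intervalIntegrable_iff.2 ((hpos.add hconst).mono'
    (Real.measurable_log.comp_aemeasurable
      hmeas.norm.aemeasurable).aestronglyMeasurable.restrict ?_)
  filter_upwards [ae_restrict_of_ae hb] with t ⟨hb1, _, _, hj⟩
  have h1 := hj 0 h0
  simp only [norm_zero, map_zero, zero_mul, sub_zero, norm_one, one_pow, mul_one] at h1
  norm_num at h1
  have h2 : 1 - ‖θ 0‖ ≤ ‖1 - conj (θ 0) * b t‖ := by
    have := norm_sub_norm_le 1 (conj (θ 0) * b t)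
    rwa [norm_one, norm_mul, RCLike.norm_conj, hb1, mul_one] at this
  have h3 : c ≤ ‖D (circleMap 0 1 t)‖ := by
    rw [div_le_iff₀ (one_sub_norm_sq_pos ha)]
    have := pow_le_pow_left₀ (by linarith) h2 2
    linarith
  have h4 : Real.log c ≤ Real.log ‖D (circleMap 0 1 t)‖ := Real.log_le_log hc h3
  have h5 : Real.log ‖D (circleMap 0 1 t)‖ ≤ Real.posLog ‖D (circleMap 0 1 t)‖ := le_max_right _ _
  have h6 : 0 ≤ Real.posLog ‖D (circleMap 0 1 t)‖ := Real.posLog_nonneg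
  simp only [Pi.add_apply, Real.norm_eq_abs]
  rw [abs_le]
  constructor
  · linarith [neg_abs_le (Real.log c)]
  · linarith [abs_nonneg (Real.log c)]

lemma norm_outer {h : ℂ → ℝ} (hh : CircleIntegrable (fun ζ => Real.log (h ζ)) 0 1) {z : ℂ}
    (hz : z ∈ ball (0 : ℂ) 1) :
    ‖outer h z‖ = Real.exp ((2 * Real.pi)⁻¹ * ∫ t in (0 : ℝ)..2 * Real.pi,
      poissonKernel 0 z (circleMap 0 1 t) * Real.log (h (circleMap 0 1 t))) := by
  rw [outer, norm_exp]
  have := re_circleAverage_herglotzRieszKernel_smul hh hz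
  simp only [smul_eq_mul] at this
  rw [this, ← poissonKernel_eq_re_herglotzRieszKernel]
  rfl

lemma IsInner.le_norm_outer {θ : ℂ → ℂ} (hθ : IsInner θ)
    (hnonconst : ¬ ∃ c : ℂ, ∀ z ∈ ball (0 : ℂ) 1, θ z = c) (hN : IsNevanlinna (deriv θ))
    {z : ℂ} (hz : z ∈ ball (0 : ℂ) 1) :
    (1 - ‖θ z‖ ^ 2) / (1 - ‖z‖ ^ 2) ≤ ‖outer (fun ζ => ‖boundaryValue (deriv θ) ζ‖) z‖ := by
  have hint := hθ.circleIntegrable_log_norm_boundaryValue_deriv hnonconst hN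
  rw [norm_outer hint hz]
  obtain ⟨b, hb⟩ := hθ.ae_boundary_deriv hnonconst hN
  have hz1 : ‖z‖ < 1 := by simpa using hz
  have ha := hθ.norm_lt_one hnonconst hz
  set a := θ z with ha_def
  set D : ℂ → ℂ := boundaryValue (deriv θ)
  have hzp := one_sub_norm_sq_pos hz1
  have hap := one_sub_norm_sq_pos ha
  set g₁ : ℝ → ℂ := fun t => log (1 - conj a * b t)
  set g₂ : ℝ → ℂ := fun t => log (1 - conj z * circleMap 0 1 t)
  have hH₁ := isHInfty_log_one_sub_conj_mul hθ.1.1 (fun w hw => hθ.norm_le_one hw) ha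
  have hH₂ := isHInfty_log_one_sub_conj_mul (f := fun w => w) (by fun_prop)
    (fun w hw => (mem_ball_zero_iff.1 hw).le) hz1
  have hl₁ : ∀ᵐ t : ℝ, Tendsto (fun r : ℝ => log (1 - conj a * θ (circleMap 0 r t))) (𝓝[<] 1)
      (𝓝 (g₁ t)) :=
    hb.mono fun t ht => tendsto_log_one_sub_conj_mul ht.2.1 ht.1 ha
  have hl₂ : ∀ᵐ t : ℝ, Tendsto (fun r : ℝ => log (1 - conj z * circleMap 0 r t)) (𝓝[<] 1)
      (𝓝 (g₂ t)) := by
    refine ae_of_all _ fun t => tendsto_log_one_sub_conj_mul ?_ (by simp) hz1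
    have : Continuous fun r : ℝ => circleMap 0 r t := by unfold circleMap; fun_prop
    exact (this.tendsto 1).mono_left nhdsWithin_le_nhds
  have hPc := continuous_poissonKernel_circleMap hz
  have hre : ∀ {g : ℝ → ℂ} {G : ℂ → ℂ}, IsHInfty G →
      (∀ᵐ t : ℝ, Tendsto (fun r : ℝ => G (circleMap 0 r t)) (𝓝[<] 1) (𝓝 (g t))) →
      IntervalIntegrable (fun t => poissonKernel 0 z (circleMap 0 1 t) * (g t).re) volume 0
        (2 * Real.pi) ∧
      ∫ t in (0 : ℝ)..2 * Real.pi, poissonKernel 0 z (circleMap 0 1 t) * (g t).re =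
        2 * Real.pi * (G z).re := by
    intro g G hG hg
    have hi : IntervalIntegrable (fun t => poissonKernel 0 z (circleMap 0 1 t) • g t) volume 0
        (2 * Real.pi) := by
      simpa [real_smul] using (hG.intervalIntegrable_of_radial_limit hg).continuousOn_mul
        (continuous_ofReal.comp hPc).continuousOn
    have e : ∀ t, reCLM (poissonKernel 0 z (circleMap 0 1 t) • g t) =
        poissonKernel 0 z (circleMap 0 1 t) * (g t).re := fun t => by simp
    constructor
    · simp_rw [← e]
      exact ⟨reCLM.integrable_comp hi.1, reCLM.integrable_comp hi.2⟩
    · simp_rw [← e]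
      rw [reCLM.intervalIntegral_comp_comm hi, ← hG.integral_poissonKernel_smul hg hz]
      simp
      field_simp
  obtain ⟨hi₁, hI₁⟩ := hre hH₁ hl₁
  obtain ⟨hi₂, hI₂⟩ := hre hH₂ hl₂
  rw [← ha_def, re_log_one_sub_conj_mul_self ha] at hI₁
  rw [re_log_one_sub_conj_mul_self hz1] at hI₂
  set L : ℝ := Real.log (1 - ‖z‖ ^ 2) - Real.log (1 - ‖a‖ ^ 2) with hL
  have hiP : IntervalIntegrable (fun t => poissonKernel 0 z (circleMap 0 1 t)) volume 0
      (2 * Real.pi) := hPc.intervalIntegrable _ _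
  have hIP := integral_poissonKernel_circleMap hz
  rw [inv_mul_eq_iff_eq_mul₀ Real.two_pi_pos.ne', mul_one] at hIP
  -- The integrand is the Poisson kernel times the logarithm of Julia's lower bound for `|θ'|`. Its
  -- mean is `L + 2 log (1 - |a|²) - 2 log (1 - |z|²) = -L`.
  have hlow : ∫ t in (0 : ℝ)..2 * Real.pi, (L * poissonKernel 0 z (circleMap 0 1 t) +
      2 * (poissonKernel 0 z (circleMap 0 1 t) * (g₁ t).re) -
      2 * (poissonKernel 0 z (circleMap 0 1 t) * (g₂ t).re)) = 2 * Real.pi * -L := by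
    rw [intervalIntegral.integral_sub ((hiP.const_mul _).add (hi₁.const_mul _)) (hi₂.const_mul _),
      intervalIntegral.integral_add (hiP.const_mul _) (hi₁.const_mul _),
      intervalIntegral.integral_const_mul, intervalIntegral.integral_const_mul,
      intervalIntegral.integral_const_mul, hIP, hI₁, hI₂, hL]
    ring
  have hmono : 2 * Real.pi * -L ≤ ∫ t in (0 : ℝ)..2 * Real.pi,
      poissonKernel 0 z (circleMap 0 1 t) * Real.log ‖D (circleMap 0 1 t)‖ := by
    rw [← hlow]
    refine intervalIntegral.integral_mono_ae Real.two_pi_pos.le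
      (((hiP.const_mul _).add (hi₁.const_mul _)).sub (hi₂.const_mul _))
      (IntervalIntegrable.continuousOn_mul hint hPc.continuousOn) ?_
    filter_upwards [hb] with t ⟨hb1, _, _, hj⟩
    have hP := poissonKernel_nonneg (ζ := circleMap 0 1 t) hz1.le (by simp)
    have p1 := norm_one_sub_conj_mul_pos ha hb1
    have p2 := norm_one_sub_conj_mul_pos (b := circleMap 0 1 t) hz1 (by simp)
    have h1 := hj z hz
    have hD : 0 < ‖D (circleMap 0 1 t)‖ := by
      have : 0 < (1 - ‖a‖ ^ 2) * ‖1 - conj z * circleMap 0 1 t‖ ^ 2 * ‖D (circleMap 0 1 t)‖ :=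
        lt_of_lt_of_le (by positivity) h1
      exact pos_of_mul_pos_right this (by positivity)
    have h2 := Real.log_le_log (by positivity) h1
    rw [Real.log_mul hzp.ne' (by positivity), Real.log_mul (by positivity) hD.ne',
      Real.log_mul hap.ne' (by positivity), Real.log_pow, Real.log_pow] at h2
    push_cast at h2
    simp only [g₁, g₂, log_re]
    have h3 : L + 2 * Real.log ‖1 - conj a * b t‖ - 2 * Real.log ‖1 - conj z * circleMap 0 1 t‖ ≤
        Real.log ‖D (circleMap 0 1 t)‖ := by
      rw [hL]; linarith
    have := mul_le_mul_of_nonneg_left h3 hP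
    linarith
  calc (1 - ‖a‖ ^ 2) / (1 - ‖z‖ ^ 2) = Real.exp (-L) := by
        rw [hL, neg_sub, Real.exp_sub, Real.exp_log hap, Real.exp_log hzp]
    _ ≤ _ := by
        refine Real.exp_le_exp.2 ?_
        rw [← inv_mul_cancel_left₀ Real.two_pi_pos.ne' (-L)]
        gcongr

end DiskFunctions
end

theorem corollary1 (θ : ℂ → ℂ) (hθ : DiskFunctions.IsInner θ)
    (hnonconst : ¬ ∃ c : ℂ, ∀ z ∈ ball (0 : ℂ) 1, θ z = c)
    (hN : DiskFunctions.IsNevanlinna (deriv θ)) :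
    -- the boundary function of `θ'` exists and is nonzero almost everywhere
    (∀ᵐ t : ℝ, ∃ w : ℂ, w ≠ 0 ∧
      Tendsto (deriv θ) (DiskFunctions.nontangential (circleMap 0 1 t)) (𝓝 w)) ∧
    -- `log |θ'|` is integrable on the unit circle
    CircleIntegrable (fun ζ => Real.log ‖DiskFunctions.boundaryValue (deriv θ) ζ‖) 0 1 ∧
    -- the estimate by the outer function with modulus `|θ'|`
    ∀ z ∈ ball (0 : ℂ) 1,
      (1 - ‖θ z‖ ^ 2) / (1 - ‖z‖ ^ 2) ≤
        ‖DiskFunctions.outer (fun ζ => ‖DiskFunctions.boundaryValue (deriv θ) ζ‖) z‖ := by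
  refine ⟨?_, hθ.circleIntegrable_log_norm_boundaryValue_deriv hnonconst hN,
    fun z hz => hθ.le_norm_outer hnonconst hN hz⟩
  obtain ⟨b, hb⟩ := hθ.ae_boundary_deriv hnonconst hN
  filter_upwards [hb] with t ⟨hb1, _, hw, hj⟩
  -- A zero limit would make the right side of Julia's inequality at `z = 0` vanish while the left
  -- side is positive.
  refine ⟨_, fun h => ?_, hw⟩
  have h0 : (0 : ℂ) ∈ ball (0 : ℂ) 1 := by simp
  have h1 := hj 0 h0
  have h2 := DiskFunctions.norm_one_sub_conj_mul_pos (hθ.norm_lt_one hnonconst h0) hb1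
  rw [h, norm_zero, mul_zero] at h1
  nlinarith [pow_pos h2 2]
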